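/- Proposition (Ammann–Beenker rhomb–square tiling). Identify the plane with $\mathbb C$ and put $\zeta=e^{i\pi/4}$ and $\lambda=1+\sqrt2=1+\zeta+\zeta^{-1}$. For $p,v\in\mathbb C$ with $|v|=1$ let $\mathrm{sq}(p,v)$ be the unit square with corners $p,\ p+\zeta v,\ p+\sqrt2\,v,\ p+\zeta^{-1}v$, decorated with an arrow along its diagonal from $p$ (tail) to $p+\sqrt2\,v$ (head), and let $\mathrm{rh}(p,v)$ be the unit rhomb with corners $p,\ p+v,\ p+v+\zeta v,\ p+\zeta v$ (with angle $\pi/4$ at $p$). The Ammann–Beenker substitution $\sigma$ replaces a tile by the tiles of its level-1 supertile, which has as outline the image of the tile under $z\mapsto\lambda z$; the squares that are cut into two halves along their diagonal by an outline are shared by the two adjacent supertiles. Writing $[a]=\lambda p+av$: * $\sigma(\mathrm{sq}(p,v))$ (the "diamond": one whole square, four half squares, four rhombs) consists of the inner square $\mathrm{sq}([1+\sqrt2],-v)$, the squares $\mathrm{sq}([1+\zeta^2],\zeta^5v)$, $\mathrm{sq}([1+\zeta^{-2}],\zeta^3v)$, $\mathrm{sq}([2+\zeta],\zeta^3v)$,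 $\mathrm{sq}([2+\zeta^{-1}],\zeta^5v)$, and the rhombs $\mathrm{rh}([1],\zeta v)$, $\mathrm{rh}([1],\zeta^{-2}v)$, $\mathrm{rh}([1+\zeta],\zeta^{-1}v)$, $\mathrm{rh}([1+\zeta^{-1}],v)$; * $\sigma(\mathrm{rh}(p,v))$ (the "rhombus": four half squares, three rhombs) consists of the rhombs $\mathrm{rh}([0],v)$, $\mathrm{rh}([1+\zeta+\zeta^2],\zeta^{-2}v)$, $\mathrm{rh}([1+\zeta+\zeta^2+\zeta^{-1}],v)$ and the squares $\mathrm{sq}([1],v)$, $\mathrm{sq}([\zeta],\zeta v)$, $\mathrm{sq}([1+2\zeta+\zeta^2+\zeta^{-1}],-v)$, $\mathrm{sq}([2+\zeta+\zeta^2+\zeta^{-1}],\zeta^5v)$. An Ammann–Beenker tiling is an edge-to-edge tiling $T$ of the plane by such squares and rhombs that is composed of supertiles at every level: there are edge-to-edge tilings $S_0=T,S_1,S_2,\dots$ by such tiles with $S_n=\sigma(S_{n+1})$ for all $n\ge0$. Its graph has the corners of the tiles as vertices and the sides of the tiles as edges. A decomposition of $T$ into level-1 supertiles is an Ammann–Beenker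 tiling $T'$ with $\sigma(T')=T$; the external supertile vertices are the vertices of $T$ on the outlines $\lambda\,\partial t$, $t\in T'$. Let $T$ be an Ammann–Beenker tiling. Then $T$ has a decomposition $T'$ into level-1 supertiles, and for each such $T'$ the following rule is consistent and assigns a weight to every edge of $T$. Every edge incident to an external supertile vertex gets weight $1$; for every $\mathrm{sq}(p,v)\in T'$, the two sides of the inner square at $[1]$ (the head of its arrow), namely from $[1]$ to $[1+\zeta]$ and from $[1]$ to $[1+\zeta^{-1}]$, get weight $2$, and the other two sides of the inner square, from $[1+\sqrt2]$ to $[1+\zeta]$ and to $[1+\zeta^{-1}]$, get weight $1$. This weighting $w$ solves the 1-2-3 problem on the graph of $T$: the graph is locally finite, all weights lie in $\{1,2,3\}$, and any two adjacent vertices $x,y$ have different weighted degrees $s_w(x)\ne s_w(y)$, where $s_w(x)=\sum_{xy\in E}w(xy)$. Moreover, for $\mathrm{sq}(p,v)\in T'$ one has $s_w=7$ at $[1]$, $s_w=5$ at $[1+\zeta]$ and $[1+\zeta^{-1}]$, $s_w=3$ at $[1+\sqrt2]$, and $s_w=3$ at the outline vertices $[1+\zeta^{\pm2}]$, $[2+\zeta^{\pm1}]$;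 for $\mathrm{rh}(p,v)\in T'$ one has $s_w=4$ at $[1+\zeta]$ and $[1+\zeta+\zeta^2+\zeta^{-1}]$, and $s_w=3$ at the outline vertices $[1]$, $[\zeta]$, $[1+2\zeta+\zeta^2+\zeta^{-1}]$, $[2+\zeta+\zeta^2+\zeta^{-1}]$. -/

import Mathlib

noncomputable section

namespace AmmannBeenker

/-- The primitive eighth root of unity `e^{iπ/4} = (1 + i)/√2`. -/
def ζ : ℂ := (1 + Complex.I) / (Real.sqrt 2 : ℂ)

/-- The inflation factor `1 + √2` of the Ammann–Beenker substitution. -/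
def silver : ℂ := 1 + (Real.sqrt 2 : ℂ)

/-- A decorated polygonal tile in the plane `ℂ`: its corners, its sides (as unordered pairs of
corners), and the set of marked corners.  Only the tiles `square` and `rhomb` below are used;
for a square the marked corner is the tail of the arrow along its diagonal, and a rhomb has no
marked corner. -/
@[ext] structure Tile where
  corners : Set ℂ
  sides : Set (Sym2 ℂ)
  tail : Set ℂ

/-- The closed region of the plane occupied by a (convex) tile. -/
def Tile.region (t : Tile) : Set ℂ := convexHull ℝ t.corners

/-- The square with arrow along the diagonal from `p` (tail) to `p + √2 v` (head), where
`√2 = ζ + ζ⁻¹ = ζ + ζ ^ 7`; its sides have length `‖v‖`. -/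
def square (p v : ℂ) : Tile where
  corners := {p, p + ζ * v, p + (ζ + ζ ^ 7) * v, p + ζ ^ 7 * v}
  sides := {s(p, p + ζ * v), s(p + ζ * v, p + (ζ + ζ ^ 7) * v),
    s(p + (ζ + ζ ^ 7) * v, p + ζ ^ 7 * v), s(p + ζ ^ 7 * v, p)}
  tail := {p}

/-- The rhomb with an acute corner (angle `π/4`) at `p` and sides `v`, `ζ v` from `p`.  It is the
same tile as `rhomb (p + (1 + ζ) * v) (-v)`. -/
def rhomb (p v : ℂ) : Tile where
  corners := {p, p + v, p + (1 + ζ) * v, p + ζ * v}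
  sides := {s(p, p + v), s(p + v, p + (1 + ζ) * v),
    s(p + (1 + ζ) * v, p + ζ * v), s(p + ζ * v, p)}
  tail := ∅

/-- The tiles of the level-1 supertile of `square p v`, whose outline is the square with side
`1 + √2` obtained from that tile by `z ↦ (1 + √2) z`: one square inside, four rhombs inside, and
four squares that are cut into halves by the outline along their diagonals (they are listed as
whole squares; each of them is shared with the neighbouring supertile).
The arrow of the inside square is opposite to the arrow of `square p v`. -/
def squareSupertile (p v : ℂ) : Set Tile :=
  {square (silver * p + (1 + ζ + ζ ^ 7) * v) (ζ ^ 4 * v),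
   square (silver * p + (1 + ζ ^ 2) * v) (ζ ^ 5 * v),
   square (silver * p + (1 + ζ ^ 6) * v) (ζ ^ 3 * v),
   square (silver * p + (2 + ζ) * v) (ζ ^ 3 * v),
   square (silver * p + (2 + ζ ^ 7) * v) (ζ ^ 5 * v),
   rhomb (silver * p + v) (ζ * v),
   rhomb (silver * p + v) (ζ ^ 6 * v),
   rhomb (silver * p + (1 + ζ) * v) (ζ ^ 7 * v),
   rhomb (silver * p + (1 + ζ ^ 7) * v) v}

/-- The tiles of the level-1 supertile of `rhomb p v`, whose outline is the rhombus with side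
`1 + √2` obtained from that tile by `z ↦ (1 + √2) z`: three rhombs inside, and four squares that
are cut into halves by the outline along their diagonals. -/
def rhombSupertile (p v : ℂ) : Set Tile :=
  {rhomb (silver * p) v,
   rhomb (silver * p + (1 + ζ + ζ ^ 2) * v) (ζ ^ 6 * v),
   rhomb (silver * p + (1 + ζ + ζ ^ 2 + ζ ^ 7) * v) v,
   square (silver * p + v) v,
   square (silver * p + ζ * v) (ζ * v),
   square (silver * p + (1 + 2 * ζ + ζ ^ 2 + ζ ^ 7) * v) (ζ ^ 4 * v),
   square (silver * p + (2 + ζ + ζ ^ 2 + ζ ^ 7) * v) (ζ ^ 5 * v)}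

/-- The Ammann–Beenker substitution applied to one tile with sides of length `1`. -/
def substitute (t : Tile) : Set Tile :=
  {s | ∃ p v : ℂ, ‖v‖ = 1 ∧
    ((t = square p v ∧ s ∈ squareSupertile p v) ∨ (t = rhomb p v ∧ s ∈ rhombSupertile p v))}

/-- The Ammann–Beenker substitution applied to a set of tiles. -/
def inflate (T : Set Tile) : Set Tile := ⋃ t ∈ T, substitute t

/-- An edge-to-edge tiling of the plane by unit squares with an arrow and unit rhombs with
angles `π/4` and `3π/4`. -/
structure IsTiling (T : Set Tile) : Prop where
  proto : ∀ t ∈ T, ∃ p v : ℂ, ‖v‖ = 1 ∧ (t = square p v ∨ t = rhomb p v)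
  cover : ⋃ t ∈ T, t.region = Set.univ
  disjoint : ∀ s ∈ T, ∀ t ∈ T, s ≠ t → Disjoint (interior s.region) (interior t.region)
  edge_to_edge : ∀ s ∈ T, ∀ t ∈ T, ∀ x ∈ s.corners, x ∈ t.region → x ∈ t.corners

/-- An Ammann–Beenker rhomb–square tiling: a tiling that is composed of supertiles of the
substitution at every level, i.e. `T = S 0` for a sequence of tilings `S n` with
`S n = inflate (S (n + 1))`; a tile of `S n` stands for a level-`n` supertile of `T`, scaled down
by `(1 + √2) ^ n`. -/
def IsAmmannBeenker (T : Set Tile) : Prop :=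
  ∃ S : ℕ → Set Tile, S 0 = T ∧ ∀ n, IsTiling (S n) ∧ S n = inflate (S (n + 1))

/-- `T'` is a decomposition of `T` into level-1 supertiles: these are the images under
`z ↦ (1 + √2) z` of the tiles of the Ammann–Beenker tiling `T'`. -/
def IsDecomposition (T T' : Set Tile) : Prop :=
  IsAmmannBeenker T' ∧ inflate T' = T

/-- The graph of the tiling: `x` and `y` are adjacent if they span a side of a tile.
(Points of `ℂ` that are not corners of tiles are isolated and play no role.) -/
def graph (T : Set Tile) : SimpleGraph ℂ where
  Adj x y := x ≠ y ∧ ∃ t ∈ T, s(x, y) ∈ t.sides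
  symm := ⟨fun x y h => ⟨h.1.symm, by rw [Sym2.eq_swap]; exact h.2⟩⟩
  loopless := ⟨fun _ h => h.1 rfl⟩

/-- The union of the outlines of the supertiles; the vertices of the tiling on it are the external
supertile vertices. -/
def outline (T' : Set Tile) : Set ℂ :=
  {x | ∃ t ∈ T', ∃ a b : ℂ, s(a, b) ∈ t.sides ∧ x ∈ segment ℝ (silver * a) (silver * b)}

/-- The weighting rule: edges incident to an external supertile vertex get weight `1`, and the
four remaining edges in each square supertile (the sides of its inside square) get weight `2` if
they contain the head of the arrow of the inside square, and `1` otherwise.  (In a rhomb supertile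
every edge is incident to an external vertex.) -/
structure IsWeighting (T T' : Set Tile) (w : Sym2 ℂ → ℕ) : Prop where
  external : ∀ e ∈ (graph T).edgeSet, (∃ x ∈ e, x ∈ outline T') → w e = 1
  internal : ∀ p v : ℂ, ‖v‖ = 1 → square p v ∈ T' →
    w s(silver * p + v, silver * p + (1 + ζ) * v) = 2 ∧
    w s(silver * p + v, silver * p + (1 + ζ ^ 7) * v) = 2 ∧
    w s(silver * p + (1 + ζ + ζ ^ 7) * v, silver * p + (1 + ζ) * v) = 1 ∧
    w s(silver * p + (1 + ζ + ζ ^ 7) * v, silver * p + (1 + ζ ^ 7) * v) = 1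

/-- The weighted degree `∑ w(xy)` over the neighbours `y` of `x`. -/
def weightedDegree (G : SimpleGraph ℂ) (w : Sym2 ℂ → ℕ) (x : ℂ) : ℕ :=
  ∑ᶠ y ∈ G.neighborSet x, w s(x, y)

/-- `w` is a solution of the 1-2-3 problem for the locally finite graph `G`: the edges have
weights in `{1, 2, 3}` and adjacent vertices have different weighted degrees. -/
structure IsSolution123 (G : SimpleGraph ℂ) (w : Sym2 ℂ → ℕ) : Prop where
  locallyFinite : ∀ x, (G.neighborSet x).Finite
  weights : ∀ e ∈ G.edgeSet, w e ∈ ({1, 2, 3} : Set ℕ)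
  colouring : ∀ x y, G.Adj x y → weightedDegree G w x ≠ weightedDegree G w y

/-- The weighted degrees at the vertices other than the corners of the supertiles. -/
structure HasDisplayedSums (T T' : Set Tile) (w : Sym2 ℂ → ℕ) : Prop where
  square_sums : ∀ p v : ℂ, ‖v‖ = 1 → square p v ∈ T' →
    weightedDegree (graph T) w (silver * p + v) = 7 ∧
    weightedDegree (graph T) w (silver * p + (1 + ζ) * v) = 5 ∧
    weightedDegree (graph T) w (silver * p + (1 + ζ ^ 7) * v) = 5 ∧
    weightedDegree (graph T) w (silver * p + (1 + ζ + ζ ^ 7) * v) = 3 ∧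
    weightedDegree (graph T) w (silver * p + (1 + ζ ^ 2) * v) = 3 ∧
    weightedDegree (graph T) w (silver * p + (1 + ζ ^ 6) * v) = 3 ∧
    weightedDegree (graph T) w (silver * p + (2 + ζ) * v) = 3 ∧
    weightedDegree (graph T) w (silver * p + (2 + ζ ^ 7) * v) = 3
  rhomb_sums : ∀ p v : ℂ, ‖v‖ = 1 → rhomb p v ∈ T' →
    weightedDegree (graph T) w (silver * p + (1 + ζ) * v) = 4 ∧
    weightedDegree (graph T) w (silver * p + (1 + ζ + ζ ^ 2 + ζ ^ 7) * v) = 4 ∧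
    weightedDegree (graph T) w (silver * p + v) = 3 ∧
    weightedDegree (graph T) w (silver * p + ζ * v) = 3 ∧
    weightedDegree (graph T) w (silver * p + (1 + 2 * ζ + ζ ^ 2 + ζ ^ 7) * v) = 3 ∧
    weightedDegree (graph T) w (silver * p + (2 + ζ + ζ ^ 2 + ζ ^ 7) * v) = 3

end AmmannBeenker

end

/-!
The weighting is determined by the stars of the vertices of `T = inflate T'`, and these are found
from the substitution alone.

Every side of an outline consists of a unit edge and of the diagonal of a halved square.  The
supertile on one side of it decides at which end the diagonal lies; were the supertile on the other
side to decide differently, two squares of `T` would overlap (`not_opposite_squares`).  Hence both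
supertiles at a side of `T'` are known to halve the same square (`IsDiagonalSide`), and the stars of
all vertices of `T` except the corners of supertiles can be read off.  The tail of a halved square
is surrounded by this square and two obtuse corners, so its degree is `3`, and all its edges have
weight `1`.  The inner vertices of the supertile of a square have the weighted degrees
`2 + 1 + 1 + 1 + 2`, `1 + 1 + 2 + 1` (twice) and `1 + 1 + 1`, those of the supertile of a rhomb
have degree `4`.  The rule is consistent because the four corners of an inner square lie in the
interior of its supertile.

Every edge of `T` that joins two vertices of known weighted degree joins different values, so it
remains to treat the edges at the corners `λ x` of supertiles, where `x` is a vertex of `T'`.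
All edges there have weight `1`.  Around `λ x` there are only squares and acute corners of rhombs,
so if `a` is the number of acute corners, then the degree is `4 + a / 2`, which is never `3`
(`exists_corner_fan`).  The neighbours of `λ x` with weighted degree other than `3` are of the
following kinds:

* at an obtuse corner of a rhomb of `T'`, the inner vertices of degree `4`; here `a` is positive
  because the supertile has an acute corner in the middle of that angle;
* at the tail of the arrow of a square of `T'`, the vertex of weighted degree `7`; here the
  supertile starts with halves of two squares of `T`, so `a ≤ 4`;
* at the left and right corners of a square of `T'`, the vertices of weighted degree `5`; here
  `a ≥ 3` (`exists_three_acute`).  This is the only place where it matters that `T'` is itself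
  inflated from a tiling: in such a tiling a left or right corner of a square always meets a rhomb
  (`sideCornersMeetRhombs_inflate`).

The underlying facts on edge-to-edge tilings, namely that every side of a tile is shared with
a second tile and that every vertex is surrounded by a cycle of tiles with angles adding up to
`2π`, are `IsTiling.exists_opposite` and `IsTiling.exists_fan`.
-/

noncomputable section

namespace AmmannBeenker

open Filter Topology

/-! ### Arithmetic of the eighth root of unity -/

theorem sqrt_two_sq : (Real.sqrt 2 : ℂ) ^ 2 = 2 := by
  rw [← Complex.ofReal_pow, Real.sq_sqrt (by norm_num)]; norm_num

theorem sqrt_two_ne : (Real.sqrt 2 : ℂ) ≠ 0 := by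
  have := sqrt_two_sq
  intro h; rw [h] at this; norm_num at this

theorem zeta_pow_four : ζ ^ 4 = -1 := by
  have h := sqrt_two_sq
  have h2 := sqrt_two_ne
  have hI := Complex.I_sq
  unfold ζ
  field_simp
  grind

theorem silver_eq : silver = 1 + ζ - ζ ^ 3 := by
  have h := sqrt_two_sq
  have h2 := sqrt_two_ne
  have hI := Complex.I_sq
  unfold silver ζ
  field_simp
  grind

theorem sqrt_two_eq : (Real.sqrt 2 : ℂ) = ζ - ζ ^ 3 := by
  have := silver_eq
  unfold silver at this
  linear_combination this

theorem zeta_sq : ζ ^ 2 = Complex.I := by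
  have h := sqrt_two_sq
  have h2 := sqrt_two_ne
  have hI := Complex.I_sq
  unfold ζ
  field_simp
  grind

theorem norm_zeta : ‖ζ‖ = 1 := by
  have h : ‖ζ‖ ^ 4 = 1 := by rw [← norm_pow, zeta_pow_four]; simp
  exact (pow_eq_one_iff_of_nonneg (norm_nonneg _) (by norm_num)).1 h

theorem zeta_ne_zero : ζ ≠ 0 := by
  intro h; have := norm_zeta; rw [h] at this; simp at this

theorem norm_zeta_pow_mul (n : ℕ) {u : ℂ} (hu : ‖u‖ = 1) : ‖ζ ^ n * u‖ = 1 := by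
  rw [norm_mul, norm_pow, norm_zeta, hu]; simp

theorem zeta_eq :
    ζ = ((Real.sqrt 2 / 2 : ℝ) : ℂ) + ((Real.sqrt 2 / 2 : ℝ) : ℂ) * Complex.I := by
  have h := sqrt_two_sq
  have h2 := sqrt_two_ne
  unfold ζ
  push_cast
  field_simp
  grind

theorem zeta_re : ζ.re = Real.sqrt 2 / 2 := by
  rw [zeta_eq]; simp

theorem zeta_im : ζ.im = Real.sqrt 2 / 2 := by
  rw [zeta_eq]; simp

theorem zeta_cube_im : (ζ ^ 3).im = Real.sqrt 2 / 2 := by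
  rw [pow_succ, zeta_sq]; simp [zeta_re]

theorem zeta_pow_im_pos {k : ℕ} (h1 : 1 ≤ k) (h3 : k ≤ 3) : 1 / 2 < (ζ ^ k).im := by
  have h : (1 : ℝ) < Real.sqrt 2 := by
    rw [Real.lt_sqrt] <;> norm_num
  interval_cases k
  · rw [pow_one, zeta_im]; linarith
  · rw [zeta_sq]; norm_num
  · rw [zeta_cube_im]; linarith

theorem zeta_pow_eq_one {n : ℕ} : ζ ^ n = 1 ↔ 8 ∣ n := by
  have : IsPrimitiveRoot ζ (2 ^ (2 + 1)) := by
    rw [IsPrimitiveRoot.iff_orderOf]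
    apply orderOf_eq_prime_pow
    · norm_num [zeta_pow_four]
    · have := zeta_pow_four
      norm_num
      grind
  exact this.pow_eq_one_iff_dvd n

theorem zeta_pow_inj {i j : ℕ} {u : ℂ} (hu : ‖u‖ = 1) (hij : i ≤ j) (hj : j < i + 8)
    (h : ζ ^ i * u = ζ ^ j * u) : i = j := by
  have hu0 : u ≠ 0 := by intro h; simp [h] at hu
  have h1 := mul_right_cancel₀ hu0 h
  obtain ⟨d, rfl⟩ := Nat.exists_eq_add_of_le hij
  rw [pow_add] at h1
  have h2 : ζ ^ d = 1 := by
    have := pow_ne_zero i zeta_ne_zero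
    exact mul_left_cancel₀ this (by rw [← h1, mul_one])
  have := zeta_pow_eq_one.1 h2
  omega

/-! ### Parallelograms -/

/-- The real-linear parametrization `(a, b) ↦ a u + b w` of the plane by a basis `u`, `w`. -/
def combination (u w : ℂ) (h : (w / u).im ≠ 0) : (ℝ × ℝ) ≃ₗ[ℝ] ℂ where
  toFun c := (c.1 : ℂ) * u + (c.2 : ℂ) * w
  map_add' a b := by simp only [Prod.fst_add, Prod.snd_add]; push_cast; ring
  map_smul' r a := by simp; ring
  invFun z := ((z / u).re - (z / u).im / (w / u).im * (w / u).re, (z / u).im / (w / u).im)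
  left_inv c := by
    have hu : u ≠ 0 := by rintro rfl; simp at h
    have h1 : ((c.1 : ℂ) * u + (c.2 : ℂ) * w) / u = (c.1 : ℂ) + (c.2 : ℂ) * (w / u) := by
      field_simp
    ext
    · simp only [h1]; simp; field_simp; ring
    · simp only [h1]; simp; field_simp
  right_inv z := by
    have hu : u ≠ 0 := by rintro rfl; simp at h
    have h1 : z = (z / u) * u := by field_simp
    have h2 : w = (w / u) * u := by field_simp
    have h3 : z / u = (((z / u).re - (z / u).im / (w / u).im * (w / u).re : ℝ) : ℂ) +
        (((z / u).im / (w / u).im : ℝ) : ℂ) * (w / u) := by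
      apply Complex.ext
      · simp
      · simp; field_simp
    simp only
    conv_rhs => rw [h1, h3]
    push_cast
    field_simp

/-- The real coordinates of a point of the plane with respect to a basis `u`, `w`. -/
def coords (u w : ℂ) (h : (w / u).im ≠ 0) : ℂ ≃L[ℝ] ℝ × ℝ :=
  (combination u w h).toContinuousLinearEquiv.symm

theorem coords_symm {u w : ℂ} (h : (w / u).im ≠ 0) (c : ℝ × ℝ) :
    (coords u w h).symm c = (c.1 : ℂ) * u + (c.2 : ℂ) * w := rfl

theorem coords_combination {u w : ℂ} (h : (w / u).im ≠ 0) (a b : ℝ) :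
    coords u w h (a * u + b * w) = (a, b) := by
  rw [← coords_symm h (a, b), ContinuousLinearEquiv.apply_symm_apply]

theorem coords_spec {u w : ℂ} (h : (w / u).im ≠ 0) (z : ℂ) :
    z = ((coords u w h z).1 : ℂ) * u + ((coords u w h z).2 : ℂ) * w := by
  rw [← coords_symm h, ContinuousLinearEquiv.symm_apply_apply]

/-- A parallelogram is the unit square in the coordinates given by its sides. -/
theorem convexHull_parallelogram (x : ℂ) {u w : ℂ} (h : (w / u).im ≠ 0) :
    convexHull ℝ {x, x + u, x + (u + w), x + w} =
      (fun z => coords u w h (z - x)) ⁻¹' (Set.Icc 0 1 ×ˢ Set.Icc 0 1) := by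
  apply Set.Subset.antisymm
  · apply convexHull_min
    · have e : ∀ z, ∀ a b : ℝ, z - x = a * u + b * w → a ∈ Set.Icc (0 : ℝ) 1 →
          b ∈ Set.Icc (0 : ℝ) 1 →
          z ∈ (fun z => coords u w h (z - x)) ⁻¹' (Set.Icc (0 : ℝ) 1 ×ˢ Set.Icc (0 : ℝ) 1) := by
        intro z a b hz ha hb
        simp only [Set.mem_preimage, hz, coords_combination]
        exact ⟨ha, hb⟩
      rintro z (rfl | rfl | rfl | rfl)
      · exact e _ 0 0 (by simp) (by simp) (by simp)
      · exact e _ 1 0 (by simp) (by simp) (by simp)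
      · exact e _ 1 1 (by simp) (by simp) (by simp)
      · exact e _ 0 1 (by simp) (by simp) (by simp)
    · have hc : Convex ℝ (Set.Icc (0 : ℝ) 1 ×ˢ Set.Icc (0 : ℝ) 1) :=
        (convex_Icc 0 1).prod (convex_Icc 0 1)
      have h1 := (hc.linear_preimage (coords u w h).toLinearMap).translate_preimage_left (-x)
      simpa [Set.preimage_preimage, sub_eq_add_neg] using h1
  · intro z hz
    obtain ⟨⟨ha0, ha1⟩, hb0, hb1⟩ := hz
    have hs := coords_spec h (z - x)
    simp only at ha0 ha1 hb0 hb1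
    set a := (coords u w h (z - x)).1
    set b := (coords u w h (z - x)).2
    have hC := convex_convexHull ℝ ({x, x + u, x + (u + w), x + w} : Set ℂ)
    have hm := subset_convexHull ℝ ({x, x + u, x + (u + w), x + w} : Set ℂ)
    have m1 := hC (hm (show x ∈ _ by simp)) (hm (show x + u ∈ _ by simp))
      (sub_nonneg.2 ha1) ha0 (by ring)
    have m2 := hC (hm (show x + w ∈ _ by simp)) (hm (show x + (u + w) ∈ _ by simp))
      (sub_nonneg.2 ha1) ha0 (by ring)
    have m3 := hC m1 m2 (sub_nonneg.2 hb1) hb0 (by ring)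
    convert m3 using 1
    simp only [Complex.real_smul]
    push_cast
    linear_combination hs

theorem interior_parallelogram (x : ℂ) {u w : ℂ} (h : (w / u).im ≠ 0) :
    interior ((fun z => coords u w h (z - x)) ⁻¹' (Set.Icc 0 1 ×ˢ Set.Icc 0 1)) =
      (fun z => coords u w h (z - x)) ⁻¹' (Set.Ioo 0 1 ×ˢ Set.Ioo 0 1) := by
  have := ((Homeomorph.addRight (-x)).trans (coords u w h).toHomeomorph).preimage_interior
    (Set.Icc (0 : ℝ) 1 ×ˢ Set.Icc (0 : ℝ) 1)
  rw [interior_prod_eq, interior_Icc] at this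
  simp only [sub_eq_add_neg]
  exact this.symm

/-! ### Corners of tiles -/

/-- The six kinds of corners that a tile can have: the acute and the obtuse corner of a rhomb, and
the tail of the arrow, the head of the arrow, and the two remaining corners of a square (`left` and
`right` as seen from the tail). -/
inductive Corner
  | acute | obtuse | tail | left | head | right

/-- The angle at a corner, as a multiple of `π / 4`. -/
def Corner.angle : Corner → ℕ
  | acute => 1
  | obtuse => 3
  | _ => 2

/-- The tile with a corner of the given kind at `x`, whose sides at `x` are `u` and
`ζ ^ c.angle * u`, in counterclockwise order. -/
def Corner.tile (x u : ℂ) : Corner → Tile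
  | acute => rhomb x u
  | obtuse => rhomb (x + ζ ^ 3 * u) (ζ ^ 7 * u)
  | tail => square x (ζ * u)
  | left => square (x + u) (ζ ^ 3 * u)
  | head => square (x + (1 + ζ ^ 2) * u) (ζ ^ 5 * u)
  | right => square (x + ζ ^ 2 * u) (ζ ^ 7 * u)

/-- The kind of the preceding corner (clockwise around the tile). -/
def Corner.prev : Corner → Corner
  | acute => obtuse
  | obtuse => acute
  | tail => left
  | left => head
  | head => right
  | right => tail

/-- The kind of the next corner (counterclockwise around the tile). -/
def Corner.next : Corner → Corner
  | acute => obtuse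
  | obtuse => acute
  | left => tail
  | head => left
  | right => head
  | tail => right

theorem Corner.one_le_angle (c : Corner) : 1 ≤ c.angle := by cases c <;> simp [angle]

theorem Corner.angle_le_three (c : Corner) : c.angle ≤ 3 := by cases c <;> simp [angle]

theorem Corner.angle_next (c : Corner) : c.next.angle = 4 - c.angle := by
  cases c <;> simp [angle, next]

theorem Corner.im_ne_zero (c : Corner) {u : ℂ} (hu : ‖u‖ = 1) :
    (ζ ^ c.angle * u / u).im ≠ 0 := by
  have hu0 : u ≠ 0 := by intro h; simp [h] at hu
  rw [mul_div_cancel_right₀ _ hu0]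
  linarith [zeta_pow_im_pos c.one_le_angle c.angle_le_three]

theorem Corner.tile_corners (c : Corner) (x u : ℂ) :
    (c.tile x u).corners = {x, x + u, x + (u + ζ ^ c.angle * u), x + ζ ^ c.angle * u} := by
  have h4 := zeta_pow_four
  cases c <;> simp only [tile, square, rhomb, angle] <;> ext z <;>
    simp only [Set.mem_insert_iff, Set.mem_singleton_iff] <;> grind

theorem Corner.tile_sides (c : Corner) (x u : ℂ) :
    (c.tile x u).sides = {s(x, x + u), s(x + u, x + (u + ζ ^ c.angle * u)),
      s(x + (u + ζ ^ c.angle * u), x + ζ ^ c.angle * u), s(x + ζ ^ c.angle * u, x)} := by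
  have h4 := zeta_pow_four
  cases c <;> simp only [tile, square, rhomb, angle] <;> ext z <;>
    simp only [Set.mem_insert_iff, Set.mem_singleton_iff] <;> grind

theorem Corner.tile_prev (c : Corner) (x u : ℂ) :
    c.prev.tile (x + ζ ^ c.angle * u) (ζ ^ (c.angle + 4) * u) = c.tile x u := by
  have h4 := zeta_pow_four
  cases c <;> simp only [tile, square, rhomb, angle, prev] <;>
    apply Tile.ext <;> ext z <;>
    simp only [Set.mem_insert_iff, Set.mem_singleton_iff, Set.mem_empty_iff_false] <;> grind

theorem Corner.tile_next (c : Corner) (x u : ℂ) :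
    c.next.tile (x + u) (ζ ^ c.angle * u) = c.tile x u := by
  have h4 := zeta_pow_four
  cases c <;> simp only [tile, square, rhomb, angle, next] <;>
    apply Tile.ext <;> ext z <;>
    simp only [Set.mem_insert_iff, Set.mem_singleton_iff, Set.mem_empty_iff_false] <;> grind

theorem square_eq (p v : ℂ) : square p v = Corner.tail.tile p (ζ ^ 7 * v) := by
  have : ζ * (ζ ^ 7 * v) = v := by grind [zeta_pow_four]
  rw [Corner.tile, this]

/-! ### Regions of tiles -/

theorem Corner.mem_region {c : Corner} {x u : ℂ} (hu : ‖u‖ = 1) {z : ℂ} :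
    z ∈ (c.tile x u).region ↔ coords u (ζ ^ c.angle * u) (c.im_ne_zero hu) (z - x) ∈
      Set.Icc (0 : ℝ) 1 ×ˢ Set.Icc (0 : ℝ) 1 := by
  rw [Tile.region, c.tile_corners, convexHull_parallelogram x (c.im_ne_zero hu)]
  rfl

theorem Corner.mem_interior {c : Corner} {x u : ℂ} (hu : ‖u‖ = 1) {z : ℂ} :
    z ∈ interior (c.tile x u).region ↔ coords u (ζ ^ c.angle * u) (c.im_ne_zero hu) (z - x) ∈
      Set.Ioo (0 : ℝ) 1 ×ˢ Set.Ioo (0 : ℝ) 1 := by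
  rw [Tile.region, c.tile_corners, convexHull_parallelogram x (c.im_ne_zero hu),
    interior_parallelogram]
  rfl

theorem Corner.combination_mem_region {c : Corner} {x u : ℂ} (hu : ‖u‖ = 1) {a b : ℝ} :
    x + (a * u + b * (ζ ^ c.angle * u)) ∈ (c.tile x u).region ↔
      a ∈ Set.Icc (0 : ℝ) 1 ∧ b ∈ Set.Icc (0 : ℝ) 1 := by
  rw [mem_region hu, add_sub_cancel_left, coords_combination]; rfl

theorem Corner.combination_mem_interior {c : Corner} {x u : ℂ} (hu : ‖u‖ = 1) {a b : ℝ} :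
    x + (a * u + b * (ζ ^ c.angle * u)) ∈ interior (c.tile x u).region ↔
      a ∈ Set.Ioo (0 : ℝ) 1 ∧ b ∈ Set.Ioo (0 : ℝ) 1 := by
  rw [mem_interior hu, add_sub_cancel_left, coords_combination]; rfl

theorem Corner.combination_inj (c : Corner) {x u : ℂ} (hu : ‖u‖ = 1) {a b a' b' : ℝ}
    (h : x + (a * u + b * (ζ ^ c.angle * u)) = x + (a' * u + b' * (ζ ^ c.angle * u))) :
    a = a' ∧ b = b' := by
  have h1 := congrArg (coords u (ζ ^ c.angle * u) (c.im_ne_zero hu)) (add_left_cancel h)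
  rw [coords_combination, coords_combination] at h1
  exact Prod.mk.inj h1

theorem Corner.exists_combination (c : Corner) (x : ℂ) {u : ℂ} (hu : ‖u‖ = 1) (z : ℂ) :
    ∃ a b : ℝ, z = x + (a * u + b * (ζ ^ c.angle * u)) :=
  ⟨_, _, by rw [← coords_spec (c.im_ne_zero hu) (z - x)]; ring⟩

theorem Corner.isClosed_region (c : Corner) (x : ℂ) {u : ℂ} (hu : ‖u‖ = 1) :
    IsClosed (c.tile x u).region := by
  have : (c.tile x u).region = (fun z => coords u (ζ ^ c.angle * u) (c.im_ne_zero hu) (z - x)) ⁻¹'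
      (Set.Icc (0 : ℝ) 1 ×ˢ Set.Icc (0 : ℝ) 1) := Set.ext fun z => c.mem_region hu
  rw [this]
  exact (isClosed_Icc.prod isClosed_Icc).preimage (by fun_prop)

theorem Corner.region_subset_closure_interior (c : Corner) (x : ℂ) {u : ℂ} (hu : ‖u‖ = 1) :
    (c.tile x u).region ⊆ closure (interior (c.tile x u).region) := by
  rw [Tile.region, (convex_convexHull ℝ _).closure_interior_eq_closure_of_nonempty_interior]
  · exact subset_closure
  · rw [← Tile.region]
    exact ⟨_, (c.combination_mem_interior hu (a := 1 / 2) (b := 1 / 2)).2 (by norm_num)⟩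

/-- `T` has a tile with a corner of kind `c` at `x`, where the first side in counterclockwise order
is the unit vector `u`. -/
structure HasCorner (T : Set Tile) (x u : ℂ) (c : Corner) : Prop where
  norm_eq : ‖u‖ = 1
  mem : c.tile x u ∈ T

theorem HasCorner.next {T : Set Tile} {x u : ℂ} {c : Corner} (h : HasCorner T x u c) :
    HasCorner T (x + u) (ζ ^ c.angle * u) c.next :=
  ⟨norm_zeta_pow_mul _ h.1, by rw [c.tile_next]; exact h.2⟩

theorem HasCorner.prev {T : Set Tile} {x u : ℂ} {c : Corner} (h : HasCorner T x u c) :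
    HasCorner T (x + ζ ^ c.angle * u) (ζ ^ (c.angle + 4) * u) c.prev :=
  ⟨norm_zeta_pow_mul _ h.1, by rw [c.tile_prev]; exact h.2⟩

theorem HasCorner.cast {T : Set Tile} {x u x' u' : ℂ} {c : Corner} (h : HasCorner T x u c)
    (hx : x = x') (hu : u = u') : HasCorner T x' u' c := by subst hx hu; exact h

theorem exists_tile_eq {p v : ℂ} {t : Tile} (hv : ‖v‖ = 1) (h : t = square p v ∨ t = rhomb p v) :
    ∃ u c, ‖u‖ = 1 ∧ t = Corner.tile p u c := by
  rcases h with rfl | rfl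
  · exact ⟨_, _, norm_zeta_pow_mul 7 hv, square_eq p v⟩
  · exact ⟨v, .acute, hv, rfl⟩

theorem Corner.tile_next_next (c : Corner) (x u : ℂ) :
    c.next.next.tile (x + (u + ζ ^ c.angle * u)) (ζ ^ 4 * u) = c.tile x u := by
  rw [← c.tile_next, ← c.next.tile_next, angle_next]
  have := c.angle_le_three
  congr 1
  · ring
  · rw [← mul_assoc, ← pow_add]; congr 2; omega

/-- A point of a tile is an interior point, or a corner, or lies inside a side. -/
theorem Corner.mem_region_cases {c : Corner} {x u z : ℂ} (hu : ‖u‖ = 1)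
    (hz : z ∈ (c.tile x u).region) :
    z ∈ interior (c.tile x u).region ∨ z ∈ (c.tile x u).corners ∨
      ∃ x' u' c', ‖u'‖ = 1 ∧ c.tile x u = Corner.tile x' u' c' ∧
        ∃ s : ℝ, 0 < s ∧ s < 1 ∧ z = x' + s * u' := by
  obtain ⟨a, b, rfl⟩ := c.exists_combination x hu z
  obtain ⟨⟨ha0, ha1⟩, hb0, hb1⟩ := (c.combination_mem_region hu).1 hz
  rw [c.combination_mem_interior hu, c.tile_corners]
  rcases ha0.eq_or_lt with rfl | ha0
  · rcases hb0.eq_or_lt with rfl | hb0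
    · right; left; simp
    · rcases hb1.eq_or_lt with rfl | hb1
      · right; left; simp
      · right; right
        refine ⟨_, _, c.prev, norm_zeta_pow_mul _ hu, (c.tile_prev x u).symm, 1 - b, by linarith,
          by linarith, ?_⟩
        rw [pow_add, zeta_pow_four]; push_cast; ring
  · rcases ha1.eq_or_lt with rfl | ha1
    · rcases hb0.eq_or_lt with rfl | hb0
      · right; left; simp
      · rcases hb1.eq_or_lt with rfl | hb1
        · right; left; simp
        · right; right
          refine ⟨_, _, c.next, norm_zeta_pow_mul _ hu, (c.tile_next x u).symm, b, hb0, hb1, ?_⟩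
          push_cast; ring
    · rcases hb0.eq_or_lt with rfl | hb0
      · right; right
        exact ⟨x, u, c, hu, rfl, a, ha0, ha1, by simp⟩
      · rcases hb1.eq_or_lt with rfl | hb1
        · right; right
          refine ⟨_, _, c.next.next, norm_zeta_pow_mul _ hu, (c.tile_next_next x u).symm,
            1 - a, by linarith, by linarith, ?_⟩
          rw [zeta_pow_four]; push_cast; ring
        · left; exact ⟨⟨ha0, ha1⟩, hb0, hb1⟩

/-! ### Tilings near a point -/

namespace IsTiling

variable {T : Set Tile}

theorem exists_corner (hT : IsTiling T) {t : Tile} (ht : t ∈ T) :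
    ∃ x u c, ‖u‖ = 1 ∧ t = Corner.tile x u c := by
  obtain ⟨p, v, hv, h⟩ := hT.proto t ht
  exact ⟨p, exists_tile_eq hv h⟩

theorem eq_of_mem_interior (hT : IsTiling T) {s t : Tile} (hs : s ∈ T) (ht : t ∈ T) {z : ℂ}
    (h1 : z ∈ interior s.region) (h2 : z ∈ interior t.region) : s = t := by
  by_contra h
  exact Set.disjoint_left.1 (hT.disjoint s hs t ht h) h1 h2

theorem eq_of_mem_interior_region (hT : IsTiling T) {s t : Tile} (hs : s ∈ T) (ht : t ∈ T) {z : ℂ}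
    (h1 : z ∈ interior s.region) (h2 : z ∈ t.region) : s = t := by
  obtain ⟨x, u, c, hu, rfl⟩ := hT.exists_corner ht
  obtain ⟨y, hy1, hy2⟩ := mem_closure_iff.1 (c.region_subset_closure_interior x hu h2) _
    isOpen_interior h1
  exact hT.eq_of_mem_interior hs ht hy1 hy2

/-- The sides of the tiles avoid the interiors of the tiles. -/
theorem side_notMem_interior (hT : IsTiling T) {x u : ℂ} {c : Corner} (h : HasCorner T x u c)
    {t : Tile} (ht : t ∈ T) {s : ℝ} (h0 : 0 ≤ s) (h1 : s ≤ 1) :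
    x + s * u ∉ interior t.region := by
  have e : x + s * u = x + (s * u + (0 : ℝ) * (ζ ^ c.angle * u)) := by push_cast; ring
  intro hz
  have := hT.eq_of_mem_interior_region ht h.mem hz (by
    rw [e, c.combination_mem_region h.1]; simp [h0, h1])
  subst this
  rw [e, c.combination_mem_interior h.1] at hz
  exact lt_irrefl _ hz.2.1

/-- Only finitely many tiles meet a given unit disc, because tiles contain disjoint discs of
a fixed radius. -/
theorem finite_meeting (hT : IsTiling T) (x : ℂ) :
    {t ∈ T | (t.region ∩ Metric.closedBall x 1).Nonempty}.Finite := by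
  -- the centre of a tile is an interior point, at distance more than `1 / 8` from the boundary
  have key : ∀ t ∈ T, ∃ m : ℂ, Metric.ball m (1 / 8) ⊆ interior t.region ∧
      ∀ z ∈ t.region, dist z m ≤ 2 := by
    intro t ht
    obtain ⟨x, u, c, hu, rfl⟩ := hT.exists_corner ht
    have hu0 : u ≠ 0 := by intro h; simp [h] at hu
    have hn : ‖ζ ^ c.angle * u‖ = 1 := norm_zeta_pow_mul _ hu
    refine ⟨x + ((1 / 2 : ℝ) * u + (1 / 2 : ℝ) * (ζ ^ c.angle * u)), ?_, ?_⟩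
    · intro z hz
      obtain ⟨a, b, rfl⟩ := c.exists_combination x hu z
      have hd : ‖((a - 1 / 2 : ℝ) : ℂ) + (b - 1 / 2 : ℝ) * ζ ^ c.angle‖ < 1 / 8 := by
        rw [mem_ball_iff_norm] at hz
        have : x + (a * u + b * (ζ ^ c.angle * u)) -
            (x + ((1 / 2 : ℝ) * u + (1 / 2 : ℝ) * (ζ ^ c.angle * u))) =
            (((a - 1 / 2 : ℝ) : ℂ) + (b - 1 / 2 : ℝ) * ζ ^ c.angle) * u := by push_cast; ring
        rwa [this, norm_mul, hu, mul_one] at hz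
      have him := (Complex.abs_im_le_norm _).trans_lt hd
      have hre := (Complex.abs_re_le_norm _).trans_lt hd
      have hz := zeta_pow_im_pos c.one_le_angle c.angle_le_three
      have hr : |(ζ ^ c.angle).re| ≤ 1 := by
        refine (Complex.abs_re_le_norm _).trans ?_
        rw [norm_pow, norm_zeta, one_pow]
      rw [Complex.add_im, Complex.ofReal_im, Complex.im_ofReal_mul, zero_add] at him
      rw [Complex.add_re, Complex.ofReal_re, Complex.re_ofReal_mul] at hre
      have hb : |b - 1 / 2| < 1 / 4 := by
        rw [abs_mul, abs_of_pos (by linarith : 0 < (ζ ^ c.angle).im)] at him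
        nlinarith [abs_nonneg (b - 1 / 2)]
      have ha : |a - 1 / 2| < 1 / 2 := by
        have h1 : |(b - 1 / 2) * (ζ ^ c.angle).re| ≤ |b - 1 / 2| := by
          rw [abs_mul]; exact mul_le_of_le_one_right (abs_nonneg _) hr
        have h2 := abs_sub_abs_le_abs_sub (a - 1 / 2) (-((b - 1 / 2) * (ζ ^ c.angle).re))
        rw [abs_neg, sub_neg_eq_add] at h2
        linarith
      rw [abs_lt] at ha hb
      rw [c.combination_mem_interior hu]
      exact ⟨⟨by linarith, by linarith⟩, by linarith, by linarith⟩
    · intro z hz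
      obtain ⟨a, b, rfl⟩ := c.exists_combination x hu z
      obtain ⟨⟨ha0, ha1⟩, hb0, hb1⟩ := (c.combination_mem_region hu).1 hz
      have : x + (a * u + b * (ζ ^ c.angle * u)) -
          (x + ((1 / 2 : ℝ) * u + (1 / 2 : ℝ) * (ζ ^ c.angle * u))) =
          (a - 1 / 2 : ℝ) * u + (b - 1 / 2 : ℝ) * (ζ ^ c.angle * u) := by push_cast; ring
      rw [dist_eq_norm, this]
      refine (norm_add_le _ _).trans ?_
      rw [norm_mul, norm_mul, hu, hn, Complex.norm_real, Complex.norm_real, mul_one, mul_one,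
        Real.norm_eq_abs, Real.norm_eq_abs]
      have h1 : |a - 1 / 2| ≤ 1 := abs_le.2 ⟨by linarith, by linarith⟩
      have h2 : |b - 1 / 2| ≤ 1 := abs_le.2 ⟨by linarith, by linarith⟩
      linarith
  choose! m hm1 hm2 using key
  obtain ⟨F, -, hF, hcov⟩ := (isCompact_closedBall x 3).finite_cover_balls
    (show (0 : ℝ) < 1 / 16 by norm_num)
  have hmem : ∀ t ∈ {t ∈ T | (t.region ∩ Metric.closedBall x 1).Nonempty},
      ∃ y ∈ F, m t ∈ Metric.ball y (1 / 16) := by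
    rintro t ⟨ht, z, hz1, hz2⟩
    have h3 : m t ∈ Metric.closedBall x 3 := by
      rw [Metric.mem_closedBall] at hz2 ⊢
      have h1 := hm2 t ht z hz1
      have h2 := dist_triangle (m t) z x
      rw [dist_comm z] at h1
      linarith
    simpa using hcov h3
  choose! f hf1 hf2 using hmem
  refine Set.Finite.of_injOn (f := f) hf1 ?_ hF
  intro s hs t ht hst
  have h1 := hf2 s hs
  have h2 := hf2 t ht
  rw [hst] at h1
  rw [Metric.mem_ball] at h1 h2
  refine hT.eq_of_mem_interior hs.1 ht.1 (hm1 s hs.1 (Metric.mem_ball_self (by norm_num)))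
    (hm1 t ht.1 ?_)
  rw [Metric.mem_ball]
  have h3 := dist_triangle_right (m s) (m t) (f t)
  linarith

/-- Near `x`, the plane is covered by the tiles that contain `x`. -/
theorem eventually_mem_region (hT : IsTiling T) (x : ℂ) :
    ∀ᶠ y in 𝓝 x, ∃ t ∈ T, x ∈ t.region ∧ y ∈ t.region := by
  have hfin := (hT.finite_meeting x).subset
    (show {t ∈ T | (t.region ∩ Metric.closedBall x 1).Nonempty ∧ x ∉ t.region} ⊆ _ from
      fun t ht => ⟨ht.1, ht.2.1⟩)
  have hcl : IsClosed (⋃ t ∈ {t ∈ T | (t.region ∩ Metric.closedBall x 1).Nonempty ∧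
      x ∉ t.region}, t.region) := by
    refine hfin.isClosed_biUnion fun t ht => ?_
    obtain ⟨x, u, c, hu, rfl⟩ := hT.exists_corner ht.1
    exact c.isClosed_region x hu
  have hx : x ∉ ⋃ t ∈ {t ∈ T | (t.region ∩ Metric.closedBall x 1).Nonempty ∧
      x ∉ t.region}, t.region := by
    simp only [Set.mem_iUnion, not_exists]
    exact fun t ht h => ht.2.2 h
  filter_upwards [hcl.isOpen_compl.mem_nhds hx, Metric.closedBall_mem_nhds x one_pos] with y hy1 hy2
  have hy : y ∈ ⋃ t ∈ T, t.region := by rw [hT.cover]; trivial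
  obtain ⟨t, ht, hyt⟩ := Set.mem_iUnion₂.1 hy
  refine ⟨t, ht, ?_, hyt⟩
  by_contra hxt
  exact hy1 (Set.mem_iUnion₂.2 ⟨t, ⟨ht, ⟨y, hyt, hy2⟩, hxt⟩, hyt⟩)

end IsTiling

theorem Corner.side_notMem_corners (c : Corner) (x : ℂ) {u : ℂ} (hu : ‖u‖ = 1) {s : ℝ}
    (h0 : 0 < s) (h1 : s < 1) : x + s * u ∉ (c.tile x u).corners := by
  rw [c.tile_corners]
  have e : ∀ a b : ℝ, x + s * u = x + (a * u + b * (ζ ^ c.angle * u)) → a = s := by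
    intro a b h
    refine (c.combination_inj (x := x) hu (b := b) (b' := 0) ?_).1
    rw [← h]; simp
  rintro (h | h | h | h)
  · linarith [e 0 0 (by rw [h]; simp)]
  · linarith [e 1 0 (by rw [h]; simp)]
  · linarith [e 1 1 (by rw [h]; simp)]
  · linarith [e 0 1 (by rw [h]; simp)]

/-- At a point inside its first side, a tile is locally the half-plane to the left of that side. -/
theorem Corner.eventually_mem_interior (c : Corner) (x : ℂ) {u d : ℂ} (hu : ‖u‖ = 1) {s : ℝ}
    (h0 : 0 < s) (h1 : s < 1) (hd : 0 < (d / u).im) :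
    ∀ᶠ ε : ℝ in 𝓝[>] 0, x + s * u + ε * d ∈ interior (c.tile x u).region := by
  obtain ⟨a, b, hab⟩ := c.exists_combination 0 hu d
  have hu0 : u ≠ 0 := by intro h; simp [h] at hu
  have hb : 0 < b := by
    have h2 : d / u = a + b * ζ ^ c.angle := by rw [hab]; field_simp; ring
    rw [h2, Complex.add_im, Complex.ofReal_im, zero_add, Complex.im_ofReal_mul] at hd
    have := zeta_pow_im_pos c.one_le_angle c.angle_le_three
    exact pos_of_mul_pos_left hd (by linarith)
  have l1 : Tendsto (fun ε : ℝ => s + ε * a) (𝓝[>] 0) (𝓝 s) := by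
    have : Tendsto (fun ε : ℝ => s + ε * a) (𝓝 0) (𝓝 (s + 0 * a)) :=
      Continuous.tendsto (by fun_prop) 0
    rw [zero_mul, add_zero] at this
    exact this.mono_left nhdsWithin_le_nhds
  have l2 : Tendsto (fun ε : ℝ => ε * b) (𝓝[>] 0) (𝓝 0) := by
    have : Tendsto (fun ε : ℝ => ε * b) (𝓝 0) (𝓝 (0 * b)) :=
      Continuous.tendsto (by fun_prop) 0
    rw [zero_mul] at this
    exact this.mono_left nhdsWithin_le_nhds
  filter_upwards [l1.eventually (Ioo_mem_nhds h0 h1), l2.eventually (gt_mem_nhds one_pos),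
    self_mem_nhdsWithin] with ε h3 h4 h5
  have e : x + s * u + ε * d =
      x + ((s + ε * a : ℝ) * u + (ε * b : ℝ) * (ζ ^ c.angle * u)) := by
    rw [hab]; push_cast; ring
  rw [e, c.combination_mem_interior hu]
  exact ⟨h3, mul_pos h5 hb, h4⟩

theorem one_add_re_pos {r : ℂ} (h : ‖r‖ = 1) (h1 : r ≠ -1) : 0 < 1 + r.re := by
  have h2 : r.re * r.re + r.im * r.im = 1 := by
    rw [← Complex.normSq_apply, Complex.normSq_eq_norm_sq, h]; norm_num
  by_contra! h3
  apply h1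
  have h4 : r.re = -1 := by nlinarith [mul_self_nonneg r.im]
  have h5 : r.im = 0 := by rw [h4] at h2; nlinarith
  exact Complex.ext (by simpa using h4) (by simpa using h5)

namespace IsTiling

variable {T : Set Tile}

/-- In an edge-to-edge tiling every side of a tile is also a side of a tile on its other side. -/
theorem exists_opposite (hT : IsTiling T) {a u : ℂ} {c : Corner} (h : HasCorner T a u c) :
    ∃ c', HasCorner T (a + u) (-u) c' := by
  have hu := h.norm_eq
  have hu0 : u ≠ 0 := by intro h; simp [h] at hu
  set m := a + ((1 / 2 : ℝ) : ℂ) * u with hm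
  have hmt : m ∈ (c.tile a u).region := by
    have e : m = a + ((1 / 2 : ℝ) * u + (0 : ℝ) * (ζ ^ c.angle * u)) := by rw [hm]; simp
    rw [e, c.combination_mem_region hu]; norm_num
  -- a tile `t` contains the midpoint `m` of the side and some point beyond it
  have hlim : Tendsto (fun ε : ℝ => m - ε * (ζ ^ c.angle * u)) (𝓝[>] 0) (𝓝 m) := by
    have : Tendsto (fun ε : ℝ => m - ε * (ζ ^ c.angle * u)) (𝓝 0)
        (𝓝 (m - (0 : ℝ) * (ζ ^ c.angle * u))) := Continuous.tendsto (by fun_prop) 0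
    rw [Complex.ofReal_zero, zero_mul, sub_zero] at this
    exact this.mono_left nhdsWithin_le_nhds
  obtain ⟨ε, ⟨t, ht, hmem, hmem'⟩, hε⟩ :=
    ((hlim.eventually (hT.eventually_mem_region m)).and self_mem_nhdsWithin).exists
  have hε : 0 < ε := hε
  have hne : t ≠ c.tile a u := by
    rintro rfl
    have e : m - ε * (ζ ^ c.angle * u) =
        a + ((1 / 2 : ℝ) * u + (-ε : ℝ) * (ζ ^ c.angle * u)) := by
      rw [hm]; push_cast; ring
    rw [e, c.combination_mem_region hu] at hmem'
    linarith [hmem'.2.1]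
  have hnc : m ∉ (c.tile a u).corners := c.side_notMem_corners a hu (by norm_num) (by norm_num)
  obtain ⟨x₀, u₀, c₀, hu₀, rfl⟩ := hT.exists_corner ht
  rcases c₀.mem_region_cases hu₀ hmem with hi | hi | ⟨x, w, c', hw, he, s, hs0, hs1, hms⟩
  · exact absurd hi (hT.side_notMem_interior h ht (by norm_num) (by norm_num))
  · exact absurd (hT.edge_to_edge _ ht _ h.mem m hi hmt) hnc
  rw [he] at ht hne hmem
  have hw0 : w ≠ 0 := by intro h; simp [h] at hw
  -- the two tiles lie on opposite sides of their common line
  have hwu : w = -u := by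
    by_contra hwu
    have h1 : 0 < (Complex.I * (u + w) / u).im := by
      have e : Complex.I * (u + w) / u = Complex.I * (1 + w / u) := by field_simp
      rw [e]
      have := one_add_re_pos (r := w / u) (by rw [norm_div, hu, hw, div_one])
        (by rw [Ne, div_eq_iff hu0]; simpa using hwu)
      simpa using this
    have h2 : 0 < (Complex.I * (u + w) / w).im := by
      have e : Complex.I * (u + w) / w = Complex.I * (1 + u / w) := by field_simp; ring
      rw [e]
      have := one_add_re_pos (r := u / w) (by rw [norm_div, hu, hw, div_one])
        (by rw [Ne, div_eq_iff hw0]; intro h; apply hwu; rw [h]; ring)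
      simpa using this
    have h3 := c.eventually_mem_interior a hu (s := 1 / 2) (by norm_num) (by norm_num) h1
    have h4 := c'.eventually_mem_interior x hw hs0 hs1 h2
    rw [← hm] at h3
    rw [← hms] at h4
    obtain ⟨δ, h5, h6⟩ := (h3.and h4).exists
    exact hne (hT.eq_of_mem_interior ht h.mem h6 h5)
  subst hwu
  have hx : x = a + ((s + 1 / 2 : ℝ) : ℂ) * u := by
    rw [hm] at hms; push_cast at hms ⊢; linear_combination -hms
  rcases lt_trichotomy s (1 / 2) with hs | rfl | hs
  · refine absurd (hT.edge_to_edge _ ht _ h.mem x (by rw [c'.tile_corners]; simp) ?_) ?_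
    · have e : x = a + ((s + 1 / 2 : ℝ) * u + (0 : ℝ) * (ζ ^ c.angle * u)) := by rw [hx]; simp
      rw [e, c.combination_mem_region hu]
      exact ⟨⟨by linarith, by linarith⟩, by norm_num⟩
    · rw [hx]; exact c.side_notMem_corners a hu (by linarith) (by linarith)
  · refine ⟨c', hw, ?_⟩
    have : a + u = x := by rw [hx]; norm_num
    rwa [this]
  · have e : a + u = x + (s - 1 / 2 : ℝ) * (-u) := by rw [hx]; push_cast; ring
    refine absurd (hT.edge_to_edge _ h.mem _ ht (a + u) (by rw [c.tile_corners]; simp) ?_) ?_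
    · have e' : a + u = x + ((s - 1 / 2 : ℝ) * (-u) + (0 : ℝ) * (ζ ^ c'.angle * (-u))) := by
        rw [e]; simp
      rw [e', c'.combination_mem_region hw]
      exact ⟨⟨by linarith, by linarith⟩, by norm_num⟩
    · rw [e]; exact c'.side_notMem_corners x hw (by linarith) (by linarith)

/-- The next tile counterclockwise around a vertex. -/
theorem exists_ccw (hT : IsTiling T) {x u : ℂ} {c : Corner} (h : HasCorner T x u c) :
    ∃ c', HasCorner T x (ζ ^ c.angle * u) c' := by
  obtain ⟨c', hc'⟩ := hT.exists_opposite h.prev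
  refine ⟨c', hc'.cast ?_ ?_⟩ <;> rw [pow_add, zeta_pow_four] <;> ring

/-- The next tile clockwise around a vertex. -/
theorem exists_cw (hT : IsTiling T) {x u : ℂ} {c : Corner} (h : HasCorner T x u c) :
    ∃ u' c', HasCorner T x u' c' ∧ ζ ^ c'.angle * u' = u := by
  obtain ⟨c', hc'⟩ := hT.exists_opposite h
  refine ⟨_, _, hc'.next.cast (by ring) rfl, ?_⟩
  have := c'.angle_le_three
  rw [c'.angle_next, ← mul_assoc, ← pow_add, Nat.sub_add_cancel (by omega), zeta_pow_four]
  ring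

/-- A side at `x` does not point into the interior of the angle of another tile at `x`. -/
theorem notMem_cone (hT : IsTiling T) {x u d : ℂ} {c c' : Corner} (h : HasCorner T x u c)
    (h' : HasCorner T x d c') {a b : ℝ} (ha : 0 < a) (hb : 0 < b)
    (hd : d = a * u + b * (ζ ^ c.angle * u)) : False := by
  have hpos : 0 < 1 / (a + b + 1) := by positivity
  refine hT.side_notMem_interior h' h.mem hpos.le (s := 1 / (a + b + 1)) ?_ ?_
  · rw [div_le_one (by positivity)]; linarith
  · have e : x + (1 / (a + b + 1) : ℝ) * d =
        x + ((1 / (a + b + 1) * a : ℝ) * u + (1 / (a + b + 1) * b : ℝ) * (ζ ^ c.angle * u)) := by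
      rw [hd]; push_cast; ring
    rw [e, c.combination_mem_interior h.norm_eq]
    refine ⟨⟨by positivity, ?_⟩, by positivity, ?_⟩
    · rw [div_mul_eq_mul_div, div_lt_one (by positivity)]; linarith
    · rw [div_mul_eq_mul_div, div_lt_one (by positivity)]; linarith

end IsTiling

/-- A positive combination of `ζ ^ i` and `ζ ^ (i + 1)` lies in the angle spanned by `1` and
`ζ ^ k` when `i < k`. -/
theorem exists_pos_combination {k i : ℕ} (hk : k ≤ 3) (hi : i < k) {α β : ℝ} (hα : 0 < α)
    (hβ : 0 ≤ β) (h : 0 < β ∨ 0 < i) :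
    ∃ a b : ℝ, 0 < a ∧ 0 < b ∧ (α : ℂ) * ζ ^ i + β * ζ ^ (i + 1) = a + b * ζ ^ k := by
  have hs := sqrt_two_eq
  have hs2 := sqrt_two_sq
  have h4 := zeta_pow_four
  have hp : 0 < Real.sqrt 2 := by positivity
  interval_cases k <;> interval_cases i
  · exact ⟨α, β, hα, by simpa using h, by push_cast; ring⟩
  · have h : 0 < β := by simpa using h
    exact ⟨α + β * (Real.sqrt 2 / 2), β * (Real.sqrt 2 / 2), by positivity, by positivity, by
      push_cast; grind⟩
  · exact ⟨α * (Real.sqrt 2 / 2), α * (Real.sqrt 2 / 2) + β, by positivity, by positivity, by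
      push_cast; grind⟩
  · have h : 0 < β := by simpa using h
    exact ⟨α + β * Real.sqrt 2, β, by positivity, by positivity, by push_cast; grind⟩
  · exact ⟨α * Real.sqrt 2 + β, α + β * Real.sqrt 2, by positivity, by positivity, by
      push_cast; grind⟩
  · exact ⟨α, α * Real.sqrt 2 + β, by positivity, by positivity, by push_cast; grind⟩

theorem exists_sector_of_quadrant {z : ℂ} (h1 : 0 < z.re) (h2 : 0 ≤ z.im) :
    ∃ j < 2, ∃ α β : ℝ, 0 < α ∧ 0 ≤ β ∧ z = α * ζ ^ j + β * ζ ^ (j + 1) := by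
  have hz := Complex.re_add_im z
  have hs := sqrt_two_eq
  have hs2 := sqrt_two_sq
  have hI := zeta_sq
  have h4 := zeta_pow_four
  rcases lt_or_ge z.im z.re with h | h
  · refine ⟨0, by norm_num, z.re - z.im, Real.sqrt 2 * z.im, by linarith, by positivity, ?_⟩
    push_cast; grind
  · refine ⟨1, by norm_num, Real.sqrt 2 * z.re, z.im - z.re, by positivity, by linarith, ?_⟩
    push_cast; grind

/-- The eight half-open sectors bounded by the powers of `ζ` cover the punctured plane. -/
theorem exists_sector {z : ℂ} (hz : z ≠ 0) :
    ∃ j < 8, ∃ α β : ℝ, 0 < α ∧ 0 ≤ β ∧ z = α * ζ ^ j + β * ζ ^ (j + 1) := by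
  have key : ∀ n ≤ 3, 0 < (ζ ^ (2 * n) * z).re → 0 ≤ (ζ ^ (2 * n) * z).im →
      ∃ j < 8, ∃ α β : ℝ, 0 < α ∧ 0 ≤ β ∧ z = α * ζ ^ j + β * ζ ^ (j + 1) := by
    intro n hn h1 h2
    obtain ⟨j, hj, α, β, hα, hβ, h⟩ := exists_sector_of_quadrant h1 h2
    have h4 := zeta_pow_four
    rcases Nat.eq_zero_or_pos n with rfl | hn0
    · exact ⟨j, by omega, α, β, hα, hβ, by simpa using h⟩
    · refine ⟨j + (8 - 2 * n), by omega, α, β, hα, hβ, ?_⟩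
      have e : ζ ^ (8 - 2 * n) * ζ ^ (2 * n) = 1 := by
        rw [← pow_add, Nat.sub_add_cancel (by omega)]; exact zeta_pow_eq_one.2 dvd_rfl
      rw [pow_add, show j + (8 - 2 * n) + 1 = (j + 1) + (8 - 2 * n) by omega, pow_add _ (j + 1)]
      linear_combination ζ ^ (8 - 2 * n) * h - z * e
  have e2 : ζ ^ (2 * 1) = Complex.I := zeta_sq
  have e4 : ζ ^ (2 * 2) = -1 := zeta_pow_four
  have e6 : ζ ^ (2 * 3) = -Complex.I := by
    rw [show 2 * 3 = 4 + 2 by norm_num, pow_add, zeta_sq, zeta_pow_four]; ring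
  have h0 : z.re ≠ 0 ∨ z.im ≠ 0 := by
    by_contra! h; exact hz (Complex.ext h.1 h.2)
  rcases lt_or_ge 0 z.re with hr | hr <;> rcases lt_or_ge z.im 0 with hi | hi
  · exact key 1 (by norm_num) (by rw [e2]; simpa using hi) (by rw [e2]; simpa using hr.le)
  · exact key 0 (by norm_num) (by simpa using hr) (by simpa using hi)
  · rcases hr.lt_or_eq with hr | hr
    · exact key 2 (by norm_num) (by rw [e4]; simpa using hr) (by rw [e4]; simpa using hi.le)
    · exact key 1 (by norm_num) (by rw [e2]; simpa using hi) (by rw [e2]; simp [hr])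
  · rcases hi.lt_or_eq with hi | hi
    · exact key 3 (by norm_num) (by rw [e6]; simpa using hi) (by rw [e6]; simpa using hr)
    · have hr : z.re < 0 := hr.lt_of_ne (h0.resolve_right (not_not.2 hi.symm))
      exact key 2 (by norm_num) (by rw [e4]; simpa using hr) (by rw [e4]; simp [← hi])

/-- The angles of two tiles at a vertex either have no sector in common or are equal. -/
theorem IsTiling.overlap {T : Set Tile} (hT : IsTiling T) {x u : ℂ} {c c' : Corner} {i : ℕ}
    (h : HasCorner T x u c) (h' : HasCorner T x (ζ ^ i * u) c') (hi : i < c.angle) :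
    i = 0 ∧ c.angle = c'.angle := by
  have hi0 : i = 0 := by
    by_contra hi0
    obtain ⟨a, b, ha, hb, hab⟩ := exists_pos_combination c.angle_le_three hi one_pos le_rfl
      (Or.inr (Nat.pos_of_ne_zero hi0))
    refine hT.notMem_cone h h' ha hb ?_
    push_cast at hab
    linear_combination u * hab
  subst hi0
  have h' : HasCorner T x u c' := h'.cast rfl (by simp)
  have key : ∀ {c c' : Corner}, HasCorner T x u c → HasCorner T x u c' →
      ¬ c.angle < c'.angle := by
    intro c c' h h' hlt
    obtain ⟨a, b, ha, hb, hab⟩ := exists_pos_combination c'.angle_le_three hlt one_pos le_rfl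
      (Or.inr c.one_le_angle)
    obtain ⟨c'', h''⟩ := hT.exists_ccw h
    refine hT.notMem_cone h' h'' ha hb ?_
    push_cast at hab
    linear_combination u * hab
  exact ⟨rfl, le_antisymm (not_lt.1 (key h' h)) (not_lt.1 (key h h'))⟩

/-! ### Vertex stars -/

/-- Consecutive tiles of `T` around `x` in counterclockwise order, starting at the side `u`, have
at `x` the kinds of corners in the list. -/
def Fan (T : Set Tile) (x : ℂ) : ℂ → List Corner → Prop
  | _, [] => True
  | u, c :: L => HasCorner T x u c ∧ Fan T x (ζ ^ c.angle * u) L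

/-- The corners of a fan, each with the direction of its first side. -/
def fanCorners : ℂ → List Corner → List (ℂ × Corner)
  | _, [] => []
  | u, c :: L => (u, c) :: fanCorners (ζ ^ c.angle * u) L

/-- The directions of the first sides of the corners of a fan. -/
def fanSides (u : ℂ) (L : List Corner) : List ℂ := (fanCorners u L).map Prod.fst

theorem fanSides_nil (u : ℂ) : fanSides u [] = [] := rfl

theorem fanSides_cons (u : ℂ) (c : Corner) (L : List Corner) :
    fanSides u (c :: L) = u :: fanSides (ζ ^ c.angle * u) L := rfl

/-- The angle spanned by a fan, as a multiple of `π / 4`; a fan of angle `8` is the star of its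
vertex. -/
def fanAngle (L : List Corner) : ℕ := (L.map Corner.angle).sum

theorem fanAngle_cons (c : Corner) (L : List Corner) : fanAngle (c :: L) = c.angle + fanAngle L :=
  rfl

theorem exists_of_mem_fanSides {L : List Corner} : ∀ {u d : ℂ}, d ∈ fanSides u L →
    ∃ i < fanAngle L, d = ζ ^ i * u := by
  induction L with
  | nil => intro u d h; simp [fanSides_nil] at h
  | cons c L ih =>
    intro u d h
    rw [fanSides_cons, List.mem_cons] at h
    rw [fanAngle_cons]
    rcases h with rfl | h
    · exact ⟨0, by have := c.one_le_angle; omega, by simp⟩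
    · obtain ⟨i, hi, rfl⟩ := ih h
      exact ⟨c.angle + i, by omega, by ring⟩

theorem nodup_fanSides {L : List Corner} : ∀ {u : ℂ}, ‖u‖ = 1 → fanAngle L ≤ 8 →
    (fanSides u L).Nodup := by
  induction L with
  | nil => intro u _ _; simp [fanSides_nil]
  | cons c L ih =>
    intro u hu h
    rw [fanAngle_cons] at h
    rw [fanSides_cons, List.nodup_cons]
    have := c.one_le_angle
    refine ⟨fun hm => ?_, ih (norm_zeta_pow_mul _ hu) (by omega)⟩
    obtain ⟨i, hi, h1⟩ := exists_of_mem_fanSides hm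
    have := zeta_pow_inj (i := 0) (j := i + c.angle) hu (by omega) (by omega)
      (by rw [pow_zero, one_mul, pow_add, mul_assoc]; exact h1)
    omega

theorem Fan.exists_cover {T : Set Tile} {x : ℂ} {L : List Corner} : ∀ {u : ℂ} {j : ℕ},
    Fan T x u L → j < fanAngle L →
    ∃ i c, i ≤ j ∧ j < i + c.angle ∧ HasCorner T x (ζ ^ i * u) c ∧
      (ζ ^ i * u, c) ∈ fanCorners u L := by
  induction L with
  | nil => intro u j _ h; simp [fanAngle] at h
  | cons c L ih =>
    intro u j h hj
    rw [fanAngle_cons] at hj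
    rcases lt_or_ge j c.angle with h1 | h1
    · exact ⟨0, c, by omega, by omega, h.1.cast rfl (by simp), by simp [fanCorners]⟩
    · obtain ⟨i, c', h2, h3, h4, h6⟩ := ih (j := j - c.angle) h.2 (by omega)
      refine ⟨i + c.angle, c', by omega, by omega, h4.cast rfl (by ring), ?_⟩
      rw [fanCorners, pow_add, mul_assoc]
      exact List.mem_cons_of_mem _ h6

theorem Fan.hasCorner {T : Set Tile} {x : ℂ} {L : List Corner} : ∀ {u d : ℂ},
    Fan T x u L → d ∈ fanSides u L → ∃ c, HasCorner T x d c := by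
  induction L with
  | nil => intro u d _ h; simp [fanSides_nil] at h
  | cons c L ih =>
    intro u d h hd
    rw [fanSides_cons, List.mem_cons] at hd
    rcases hd with rfl | hd
    · exact ⟨c, h.1⟩
    · exact ih h.2 hd

/-- The neighbours of `x` are the points `x + d`, where `d` is the first side of a tile at `x`:
every side is the first one for the tile to its left. -/
theorem graph_adj_iff {T : Set Tile} (hT : IsTiling T) {x y : ℂ} :
    (graph T).Adj x y ↔ ∃ c, HasCorner T x (y - x) c := by
  constructor
  · rintro ⟨-, t, ht, hs⟩
    obtain ⟨x₀, u, c, hu, rfl⟩ := hT.exists_corner ht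
    have h1 : HasCorner T x₀ u c := ⟨hu, ht⟩
    have h4 := zeta_pow_four
    have key : ∀ {a d : ℂ} {c : Corner}, HasCorner T a d c → s(x, y) = s(a, a + d) →
        ∃ c, HasCorner T x (y - x) c := by
      intro a d c h e
      rcases Sym2.eq_iff.1 e with ⟨rfl, rfl⟩ | ⟨rfl, rfl⟩
      · exact ⟨c, h.cast rfl (by ring)⟩
      · obtain ⟨c', h'⟩ := hT.exists_opposite h
        exact ⟨c', h'.cast rfl (by ring)⟩
    rw [c.tile_sides] at hs
    rcases hs with hs | hs | hs | hs
    · exact key h1 hs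
    · exact key h1.next (by rw [hs, add_assoc])
    · have h2 : HasCorner T (x₀ + (u + ζ ^ c.angle * u)) (ζ ^ 4 * u) c.next.next :=
        ⟨norm_zeta_pow_mul _ hu, by rw [c.tile_next_next]; exact ht⟩
      have e : x₀ + ζ ^ c.angle * u = x₀ + (u + ζ ^ c.angle * u) + ζ ^ 4 * u := by rw [h4]; ring
      exact key h2 (by rw [hs, e])
    · exact key h1.prev (by rw [hs, pow_add, h4]; congr! 2; ring)
  · rintro ⟨c, h⟩
    refine ⟨?_, _, h.mem, ?_⟩
    · rintro rfl
      have := h.norm_eq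
      simp at this
    · rw [c.tile_sides]; left; congr! 2; ring

namespace IsTiling

variable {T : Set Tile}

/-- Every vertex of a tiling is surrounded by its tiles. -/
theorem exists_fan (hT : IsTiling T) {x u : ℂ} {c : Corner} (h : HasCorner T x u c) :
    ∃ L, Fan T x u L ∧ fanAngle L = 8 := by
  have key : ∀ n j, 1 ≤ j → j + n = 8 → (∃ c', HasCorner T x (ζ ^ j * u) c') →
      ∃ L, Fan T x (ζ ^ j * u) L ∧ fanAngle L = n := by
    intro n
    induction n using Nat.strong_induction_on with
    | _ n ih =>
      rintro j hj hn ⟨c', h'⟩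
      rcases Nat.eq_zero_or_pos n with rfl | hn0
      · exact ⟨[], trivial, rfl⟩
      have hle : c'.angle ≤ n := by
        by_contra! hlt
        have h1 : HasCorner T x (ζ ^ n * (ζ ^ j * u)) c := h.cast rfl (by
          rw [← mul_assoc, ← pow_add, add_comm, hn, zeta_pow_eq_one.2 dvd_rfl, one_mul])
        have := (hT.overlap h' h1 hlt).1
        omega
      have h1 := c'.one_le_angle
      obtain ⟨c'', h''⟩ := hT.exists_ccw h'
      obtain ⟨L, hL, hs⟩ := ih (n - c'.angle) (by omega) (j + c'.angle) (by omega) (by omega)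
        ⟨c'', h''.cast rfl (by ring)⟩
      refine ⟨c' :: L, ⟨h', ?_⟩, by rw [fanAngle_cons, hs]; omega⟩
      convert hL using 1
      ring
  have h1 := c.one_le_angle
  have h3 := c.angle_le_three
  obtain ⟨L, hL, hs⟩ := key (8 - c.angle) c.angle h1 (by omega) (hT.exists_ccw h)
  exact ⟨c :: L, ⟨h, hL⟩, by rw [fanAngle_cons, hs]; omega⟩

/-- When the eight sectors at `x` are covered by angles of tiles, there is no further tile
at `x`. -/
theorem exists_of_sector_cover (hT : IsTiling T) {x u d : ℂ} {c : Corner} {P : ℂ → Corner → Prop}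
    (hu : ‖u‖ = 1) (hP : ∀ j, 8 ≤ j → j < 16 → ∃ i c', i ≤ j ∧ j < i + c'.angle ∧
      HasCorner T x (ζ ^ i * u) c' ∧ P (ζ ^ i * u) c') (h : HasCorner T x d c) :
    ∃ c', c'.angle = c.angle ∧ P d c' := by
  have hu0 : u ≠ 0 := by intro h; simp [h] at hu
  have hd0 : d ≠ 0 := by intro h0; have := h.norm_eq; simp [h0] at this
  obtain ⟨j, hj, α, β, hα, hβ, hz⟩ := exists_sector (div_ne_zero hd0 hu0)
  rw [div_eq_iff hu0] at hz
  obtain ⟨i, c', h1, h2, h3, h5⟩ := hP (j + 8) (by omega) (by omega)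
  have e8 : ζ ^ 8 = 1 := zeta_pow_eq_one.2 dvd_rfl
  have e1 : ζ ^ j = ζ ^ (j + 8 - i) * ζ ^ i := by
    rw [← pow_add, Nat.sub_add_cancel h1, pow_add, e8, mul_one]
  rcases hβ.eq_or_lt with rfl | hβ
  · have hα1 : α = 1 := by
      have h6 := h.norm_eq
      rw [hz] at h6
      simpa [norm_zeta, hu, abs_of_pos hα] using h6
    have hd : d = ζ ^ (j + 8 - i) * (ζ ^ i * u) := by
      rw [← mul_assoc, ← e1, hz, hα1]; simp
    obtain ⟨h6, h7⟩ := hT.overlap h3 (h.cast rfl hd) (by omega)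
    rw [h6, pow_zero, one_mul] at hd
    exact ⟨c', h7, hd ▸ h5⟩
  · obtain ⟨a, b, ha, hb, hab⟩ := exists_pos_combination (i := j + 8 - i) c'.angle_le_three
      (by omega) hα hβ.le (Or.inl hβ)
    refine (hT.notMem_cone h3 h ha hb ?_).elim
    have e2 : ζ ^ (j + 1) = ζ ^ (j + 8 - i + 1) * ζ ^ i := by
      rw [pow_succ, e1, pow_succ]; ring
    rw [hz, e1, e2]
    linear_combination ζ ^ i * u * hab

/-- The star of a vertex contains all tiles at that vertex. -/
theorem exists_mem_fanCorners (hT : IsTiling T) {x u d : ℂ} {c : Corner} {L : List Corner}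
    (hu : ‖u‖ = 1) (hL : Fan T x u L) (h8 : fanAngle L = 8) (h : HasCorner T x d c) :
    ∃ c', c'.angle = c.angle ∧ (d, c') ∈ fanCorners u L := by
  refine hT.exists_of_sector_cover (P := fun d c' => (d, c') ∈ fanCorners u L) hu ?_ h
  intro j hj hj'
  obtain ⟨i, c', h1, h2, h3, h4⟩ := hL.exists_cover (j := j - 8) (by omega)
  have e : ζ ^ (i + 8) * u = ζ ^ i * u := by
    rw [pow_add, zeta_pow_eq_one.2 dvd_rfl, mul_one]
  refine ⟨i + 8, c', by omega, by omega, ?_, ?_⟩ <;> rw [e] <;> assumption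

theorem mem_fanSides (hT : IsTiling T) {x u d : ℂ} {c : Corner} {L : List Corner} (hu : ‖u‖ = 1)
    (hL : Fan T x u L) (h8 : fanAngle L = 8) (h : HasCorner T x d c) : d ∈ fanSides u L := by
  obtain ⟨c', -, h'⟩ := hT.exists_mem_fanCorners hu hL h8 h
  exact List.mem_map_of_mem h'

/-- Pairwise different tiles with the same angle `k` at a vertex are counted in its star. -/
theorem card_le_count_angle (hT : IsTiling T) {x u : ℂ} {L : List Corner} (hu : ‖u‖ = 1)
    (hL : Fan T x u L) (h8 : fanAngle L = 8) {k : ℕ} (S : Finset ℂ)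
    (hS : ∀ d ∈ S, ∃ c, c.angle = k ∧ HasCorner T x d c) :
    S.card ≤ (L.map Corner.angle).count k := by
  have e : ∀ (L : List Corner) (u : ℂ), ((fanCorners u L).filter (·.2.angle = k)).length =
      (L.map Corner.angle).count k := by
    intro L
    induction L with
    | nil => intro u; simp [fanCorners]
    | cons c L ih =>
      intro u
      by_cases h : c.angle = k
      · simp [fanCorners, h, ih]
      · simp [fanCorners, h, ih]
  rw [← e L u, ← List.length_map (f := Prod.fst)]
  refine (Finset.card_le_card (t := (((fanCorners u L).filter (·.2.angle = k)).map
    Prod.fst).toFinset) fun d hd => ?_).trans (List.toFinset_card_le _)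
  obtain ⟨c, hc, h⟩ := hS d hd
  obtain ⟨c', hc', h'⟩ := hT.exists_mem_fanCorners hu hL h8 h
  simp only [List.mem_toFinset, List.mem_map, List.mem_filter, decide_eq_true_eq]
  exact ⟨_, ⟨h', hc'.trans hc⟩, rfl⟩

theorem mem_neighborSet_iff (hT : IsTiling T) {x u : ℂ} {L : List Corner} (hu : ‖u‖ = 1)
    (hL : Fan T x u L) (h8 : fanAngle L = 8) (y : ℂ) :
    y ∈ (graph T).neighborSet x ↔ y - x ∈ fanSides u L := by
  rw [SimpleGraph.mem_neighborSet, graph_adj_iff hT]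
  exact ⟨fun ⟨c, h⟩ => hT.mem_fanSides hu hL h8 h, fun h => hL.hasCorner h⟩

theorem neighborSet_eq (hT : IsTiling T) {x u : ℂ} {L : List Corner} (hu : ‖u‖ = 1)
    (hL : Fan T x u L) (h8 : fanAngle L = 8) :
    (graph T).neighborSet x = ((fanSides u L).map (x + ·)).toFinset := by
  ext y
  rw [hT.mem_neighborSet_iff hu hL h8]
  simp only [List.coe_toFinset, List.mem_map, Set.mem_ofPred_eq]
  exact ⟨fun h => ⟨_, h, by ring⟩, by rintro ⟨d, hd, rfl⟩; simpa using hd⟩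

theorem weightedDegree_eq (hT : IsTiling T) (w : Sym2 ℂ → ℕ) {x u : ℂ} {L : List Corner}
    (hu : ‖u‖ = 1) (hL : Fan T x u L) (h8 : fanAngle L = 8) :
    weightedDegree (graph T) w x = ((fanSides u L).map fun d => w s(x, x + d)).sum := by
  rw [weightedDegree, hT.neighborSet_eq hu hL h8, finsum_mem_coe_finset, List.sum_toFinset,
    List.map_map]
  · rfl
  · exact (nodup_fanSides hu h8.le).map (add_right_injective x)

theorem finite_neighborSet (hT : IsTiling T) (x : ℂ) : ((graph T).neighborSet x).Finite := by
  rcases ((graph T).neighborSet x).eq_empty_or_nonempty with h | ⟨y, hy⟩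
  · rw [h]; exact Set.finite_empty
  · obtain ⟨c, h⟩ := (graph_adj_iff hT).1 hy
    obtain ⟨L, hL, h8⟩ := hT.exists_fan h
    rw [hT.neighborSet_eq h.norm_eq hL h8]
    exact Finset.finite_toSet _

end IsTiling

/-! ### The substitution near an outline -/

/-- The outline of a supertile starts, along the first side of the corner, with the diagonal of
a square that it cuts into halves. -/
def Corner.StartsDiagonal : Corner → Prop
  | tail | right | obtuse => True
  | _ => False

/-- The outline of a supertile starts, along the second side of the corner, with the diagonal of
a square that it cuts into halves. -/
def Corner.EndsDiagonal : Corner → Prop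
  | tail | left | obtuse => True
  | _ => False

theorem mem_inflate_of_square {T' : Set Tile} {p v : ℂ} (hv : ‖v‖ = 1) (h : square p v ∈ T')
    {s : Tile} (hs : s ∈ squareSupertile p v) : s ∈ inflate T' :=
  Set.mem_iUnion₂.2 ⟨_, h, p, v, hv, Or.inl ⟨rfl, hs⟩⟩

theorem mem_inflate_of_rhomb {T' : Set Tile} {p v : ℂ} (hv : ‖v‖ = 1) (h : rhomb p v ∈ T')
    {s : Tile} (hs : s ∈ rhombSupertile p v) : s ∈ inflate T' :=
  Set.mem_iUnion₂.2 ⟨_, h, p, v, hv, Or.inr ⟨rfl, hs⟩⟩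

theorem rhomb_rotate (p v : ℂ) : rhomb (p + (1 + ζ) * v) (-v) = rhomb p v := by
  have := Corner.acute.tile_next_next p v
  simp only [Corner.next, Corner.tile, Corner.angle, pow_one, zeta_pow_four, neg_one_mul] at this
  rw [← this]; congr 1; ring

theorem square_congr {p v p' v' : ℂ} {T : Set Tile} (h : square p v ∈ T) (hp : p = p')
    (hv : v = v') : square p' v' ∈ T := by subst hp hv; exact h

theorem rhomb_congr {p v p' v' : ℂ} {T : Set Tile} (h : rhomb p v ∈ T) (hp : p = p')
    (hv : v = v') : rhomb p' v' ∈ T := by subst hp hv; exact h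

theorem rhomb_congr_rotate {p v p' v' : ℂ} {T : Set Tile} (h : rhomb p v ∈ T)
    (hp : p + (1 + ζ) * v = p') (hv : -v = v') : rhomb p' v' ∈ T := by
  subst hp hv; rwa [rhomb_rotate]

/-- The tiles of the supertile of a square. -/
theorem square_inflate {T' : Set Tile} {p v : ℂ} (hv : ‖v‖ = 1) (h : square p v ∈ T') :
    square (silver * p + (1 + ζ + ζ ^ 7) * v) (ζ ^ 4 * v) ∈ inflate T' ∧
    square (silver * p + (1 + ζ ^ 2) * v) (ζ ^ 5 * v) ∈ inflate T' ∧
    square (silver * p + (1 + ζ ^ 6) * v) (ζ ^ 3 * v) ∈ inflate T' ∧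
    square (silver * p + (2 + ζ) * v) (ζ ^ 3 * v) ∈ inflate T' ∧
    square (silver * p + (2 + ζ ^ 7) * v) (ζ ^ 5 * v) ∈ inflate T' ∧
    rhomb (silver * p + v) (ζ * v) ∈ inflate T' ∧
    rhomb (silver * p + v) (ζ ^ 6 * v) ∈ inflate T' ∧
    rhomb (silver * p + (1 + ζ) * v) (ζ ^ 7 * v) ∈ inflate T' ∧
    rhomb (silver * p + (1 + ζ ^ 7) * v) v ∈ inflate T' := by
  refine ⟨?_, ?_, ?_, ?_, ?_, ?_, ?_, ?_, ?_⟩ <;> apply mem_inflate_of_square hv h <;>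
    simp only [squareSupertile, Set.mem_insert_iff, Set.mem_singleton_iff, true_or, or_true]

/-- The tiles of the supertile of a rhomb. -/
theorem rhomb_inflate {T' : Set Tile} {p v : ℂ} (hv : ‖v‖ = 1) (h : rhomb p v ∈ T') :
    rhomb (silver * p) v ∈ inflate T' ∧
    rhomb (silver * p + (1 + ζ + ζ ^ 2) * v) (ζ ^ 6 * v) ∈ inflate T' ∧
    rhomb (silver * p + (1 + ζ + ζ ^ 2 + ζ ^ 7) * v) v ∈ inflate T' ∧
    square (silver * p + v) v ∈ inflate T' ∧
    square (silver * p + ζ * v) (ζ * v) ∈ inflate T' ∧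
    square (silver * p + (1 + 2 * ζ + ζ ^ 2 + ζ ^ 7) * v) (ζ ^ 4 * v) ∈ inflate T' ∧
    square (silver * p + (2 + ζ + ζ ^ 2 + ζ ^ 7) * v) (ζ ^ 5 * v) ∈ inflate T' := by
  refine ⟨?_, ?_, ?_, ?_, ?_, ?_, ?_⟩ <;> apply mem_inflate_of_rhomb hv h <;>
    simp only [rhombSupertile, Set.mem_insert_iff, Set.mem_singleton_iff, true_or, or_true]

theorem norm_zeta_mul {u : ℂ} (hu : ‖u‖ = 1) : ‖ζ * u‖ = 1 := by
  rw [norm_mul, norm_zeta, hu, one_mul]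

/-- The halved square at the start of a diagonal side, and the rhomb to the left of its tail. -/
theorem HasCorner.diagonal_start {T' : Set Tile} {x u : ℂ} {c : Corner} (h : HasCorner T' x u c)
    (hc : c.StartsDiagonal) :
    HasCorner (inflate T') (silver * x) (ζ ^ 7 * u) .head ∧
      HasCorner (inflate T') (silver * x + (ζ + ζ ^ 7) * u) u .obtuse := by
  obtain ⟨hu, ht⟩ := h
  have h4 := zeta_pow_four
  have hl := silver_eq
  cases c <;> simp only [Corner.StartsDiagonal] at hc <;>
    simp only [Corner.tile] at ht
  · obtain ⟨m1, m2, m3, m4, m5, m6, m7⟩ := rhomb_inflate (norm_zeta_pow_mul 7 hu) ht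
    refine ⟨⟨norm_zeta_pow_mul _ hu, square_congr m7 ?_ ?_⟩, ⟨hu, rhomb_congr m3 ?_ ?_⟩⟩ <;> grind
  · obtain ⟨m1, m2, m3, m4, m5, m6, m7, m8, m9⟩ := square_inflate (norm_zeta_mul hu) ht
    refine ⟨⟨norm_zeta_pow_mul _ hu, square_congr m3 ?_ ?_⟩, ⟨hu, rhomb_congr m7 ?_ ?_⟩⟩ <;> grind
  · obtain ⟨m1, m2, m3, m4, m5, m6, m7, m8, m9⟩ := square_inflate (norm_zeta_pow_mul 7 hu) ht
    refine ⟨⟨norm_zeta_pow_mul _ hu, square_congr m5 ?_ ?_⟩, ⟨hu, rhomb_congr m9 ?_ ?_⟩⟩ <;> grind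

/-- The rhomb at the start of a side that is not diagonal, and the halved square at the other end
of the side. -/
theorem HasCorner.unit_start {T' : Set Tile} {x u : ℂ} {c : Corner} (h : HasCorner T' x u c)
    (hc : ¬ c.StartsDiagonal) :
    HasCorner (inflate T') (silver * x) u .acute ∧
      square (silver * x + u) u ∈ inflate T' := by
  obtain ⟨hu, ht⟩ := h
  have h4 := zeta_pow_four
  have hl := silver_eq
  cases c <;> simp only [Corner.StartsDiagonal, not_true_eq_false] at hc <;>
    simp only [Corner.tile] at ht
  · obtain ⟨m1, m2, m3, m4, m5, m6, m7⟩ := rhomb_inflate hu ht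
    refine ⟨⟨hu, rhomb_congr m1 ?_ ?_⟩, square_congr m4 ?_ ?_⟩ <;> grind
  · obtain ⟨m1, m2, m3, m4, m5, m6, m7, m8, m9⟩ := square_inflate (norm_zeta_pow_mul 3 hu) ht
    refine ⟨⟨hu, rhomb_congr_rotate m6 ?_ ?_⟩, square_congr m2 ?_ ?_⟩ <;> grind
  · obtain ⟨m1, m2, m3, m4, m5, m6, m7, m8, m9⟩ := square_inflate (norm_zeta_pow_mul 5 hu) ht
    refine ⟨⟨hu, rhomb_congr_rotate m8 ?_ ?_⟩, square_congr m4 ?_ ?_⟩ <;> grind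

/-- The halved square at the end of a diagonal side, and the rhomb to the right of its tail. -/
theorem HasCorner.diagonal_end {T' : Set Tile} {x u : ℂ} {c : Corner} (h : HasCorner T' x u c)
    (hc : c.EndsDiagonal) :
    HasCorner (inflate T') (silver * x) (ζ ^ 7 * (ζ ^ c.angle * u)) .head ∧
      HasCorner (inflate T') (silver * x + (ζ + ζ ^ 7) * (ζ ^ c.angle * u))
        (ζ ^ 5 * (ζ ^ c.angle * u)) .obtuse := by
  obtain ⟨hu, ht⟩ := h
  have hn : ∀ i j, ‖ζ ^ i * (ζ ^ j * u)‖ = 1 := fun i j =>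
    norm_zeta_pow_mul i (norm_zeta_pow_mul j hu)
  have h4 := zeta_pow_four
  have hl := silver_eq
  cases c <;> simp only [Corner.EndsDiagonal] at hc <;>
    simp only [Corner.tile] at ht <;> simp only [Corner.angle]
  · obtain ⟨m1, m2, m3, m4, m5, m6, m7⟩ := rhomb_inflate (norm_zeta_pow_mul 7 hu) ht
    refine ⟨⟨hn _ _, square_congr m4 ?_ ?_⟩, ⟨hn _ _, rhomb_congr m1 ?_ ?_⟩⟩ <;> grind
  · obtain ⟨m1, m2, m3, m4, m5, m6, m7, m8, m9⟩ := square_inflate (norm_zeta_mul hu) ht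
    refine ⟨⟨hn _ _, square_congr m2 ?_ ?_⟩, ⟨hn _ _, rhomb_congr_rotate m6 ?_ ?_⟩⟩ <;> grind
  · obtain ⟨m1, m2, m3, m4, m5, m6, m7, m8, m9⟩ := square_inflate (norm_zeta_pow_mul 3 hu) ht
    refine ⟨⟨hn _ _, square_congr m4 ?_ ?_⟩, ⟨hn _ _, rhomb_congr_rotate m8 ?_ ?_⟩⟩ <;> grind

/-- The mirror image of `HasCorner.unit_start`. -/
theorem HasCorner.unit_end {T' : Set Tile} {x u : ℂ} {c : Corner} (h : HasCorner T' x u c)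
    (hc : ¬ c.EndsDiagonal) :
    HasCorner (inflate T') (silver * x) (ζ ^ 7 * (ζ ^ c.angle * u)) .acute ∧
      square (silver * x + ζ ^ c.angle * u) (ζ ^ c.angle * u) ∈ inflate T' := by
  obtain ⟨hu, ht⟩ := h
  have hn : ∀ i j, ‖ζ ^ i * (ζ ^ j * u)‖ = 1 := fun i j =>
    norm_zeta_pow_mul i (norm_zeta_pow_mul j hu)
  have h4 := zeta_pow_four
  have hl := silver_eq
  cases c <;> simp only [Corner.EndsDiagonal, not_true_eq_false] at hc <;>
    simp only [Corner.tile] at ht <;> simp only [Corner.angle]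
  · obtain ⟨m1, m2, m3, m4, m5, m6, m7⟩ := rhomb_inflate hu ht
    refine ⟨⟨hn _ _, rhomb_congr m1 ?_ ?_⟩, square_congr m5 ?_ ?_⟩ <;> grind
  · obtain ⟨m1, m2, m3, m4, m5, m6, m7, m8, m9⟩ := square_inflate (norm_zeta_pow_mul 5 hu) ht
    refine ⟨⟨hn _ _, rhomb_congr_rotate m9 ?_ ?_⟩, square_congr m5 ?_ ?_⟩ <;> grind
  · obtain ⟨m1, m2, m3, m4, m5, m6, m7, m8, m9⟩ := square_inflate (norm_zeta_pow_mul 7 hu) ht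
    refine ⟨⟨hn _ _, rhomb_congr_rotate m7 ?_ ?_⟩, square_congr m3 ?_ ?_⟩ <;> grind

/-- The supertile of a rhomb has an acute corner in the middle of each obtuse angle. -/
theorem HasCorner.obtuse_middle {T' : Set Tile} {x u : ℂ} (h : HasCorner T' x u .obtuse) :
    HasCorner (inflate T') (silver * x) (ζ * u) .acute := by
  obtain ⟨hu, ht⟩ := h
  have h4 := zeta_pow_four
  have hl := silver_eq
  obtain ⟨m1, m2, m3, m4, m5, m6, m7⟩ := rhomb_inflate (norm_zeta_pow_mul 7 hu) ht
  refine ⟨norm_zeta_mul hu, rhomb_congr_rotate m2 ?_ ?_⟩ <;> grind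

/-! ### Halved squares -/

theorem norm_sqrt_two_mul {v : ℂ} (hv : ‖v‖ = 1) : ‖(ζ + ζ ^ 7) * v‖ = Real.sqrt 2 := by
  have e : ζ + ζ ^ 7 = (Real.sqrt 2 : ℂ) := by grind [sqrt_two_eq, zeta_pow_four]
  rw [norm_mul, e, hv, Complex.norm_real, Real.norm_eq_abs, abs_of_nonneg (by positivity), mul_one]

theorem square_inj {p v p' v' : ℂ} (hv : ‖v‖ = 1) (hv' : ‖v'‖ = 1)
    (h : square p v = square p' v') : p = p' ∧ v = v' := by
  have hp : p = p' := by
    have := congrArg Tile.tail h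
    simpa [square] using this
  subst hp
  refine ⟨rfl, ?_⟩
  have hs : 1 < Real.sqrt 2 := by rw [Real.lt_sqrt] <;> norm_num
  have hc : p + (ζ + ζ ^ 7) * v ∈ (square p v').corners := by
    rw [← h]; simp [square]
  have hn := norm_sqrt_two_mul hv
  simp only [square, Set.mem_insert_iff, Set.mem_singleton_iff, add_right_inj] at hc
  rcases hc with hc | hc | hc | hc
  · rw [add_eq_left] at hc
    rw [hc, norm_zero] at hn; linarith
  · rw [hc, norm_zeta_mul hv'] at hn; linarith
  · refine mul_left_cancel₀ (a := ζ + ζ ^ 7) ?_ hc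
    intro h0; rw [h0, zero_mul, norm_zero] at hn; linarith
  · rw [hc, norm_zeta_pow_mul 7 hv'] at hn; linarith

theorem square_ne_rhomb (p v p' v' : ℂ) : square p v ≠ rhomb p' v' := by
  intro h
  have := congrArg Tile.tail h
  simp [square, rhomb] at this

/-- The two squares that can be halved by the same side of an outline overlap. -/
theorem not_opposite_squares {T : Set Tile} (hT : IsTiling T) {x d : ℂ}
    (h : HasCorner T x (ζ ^ 7 * d) .head) (h' : square (x + d) d ∈ T) : False := by
  have hd : ‖d‖ = 1 := by
    have := norm_zeta_mul h.norm_eq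
    rwa [← mul_assoc, ← pow_succ', zeta_pow_eq_one.2 dvd_rfl, one_mul] at this
  have hd' := norm_zeta_pow_mul 7 hd
  have hd0 : d ≠ 0 := by intro h; simp [h] at hd
  have hs : (Real.sqrt 2) ^ 2 = 2 := Real.sq_sqrt (by norm_num)
  have hs0 : 0 < Real.sqrt 2 := by positivity
  have hsC := sqrt_two_eq
  have hsC2 := sqrt_two_sq
  have h4 := zeta_pow_four
  rw [square_eq] at h'
  -- the midpoint of the common part of their diagonals is interior to both
  have h1 : x + ((1 + Real.sqrt 2) / 2 : ℝ) * d ∈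
      interior (Corner.head.tile x (ζ ^ 7 * d)).region := by
    have e : x + ((1 + Real.sqrt 2) / 2 : ℝ) * d =
        x + (((2 + Real.sqrt 2) / 4 : ℝ) * (ζ ^ 7 * d) +
          ((2 + Real.sqrt 2) / 4 : ℝ) * (ζ ^ Corner.head.angle * (ζ ^ 7 * d))) := by
      simp only [Corner.angle]; push_cast; grind
    rw [e, Corner.combination_mem_interior hd']
    refine ⟨⟨?_, ?_⟩, ?_, ?_⟩ <;> nlinarith
  have h2 : x + ((1 + Real.sqrt 2) / 2 : ℝ) * d ∈
      interior (Corner.tail.tile (x + d) (ζ ^ 7 * d)).region := by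
    have e : x + ((1 + Real.sqrt 2) / 2 : ℝ) * d =
        x + d + (((2 - Real.sqrt 2) / 4 : ℝ) * (ζ ^ 7 * d) +
          ((2 - Real.sqrt 2) / 4 : ℝ) * (ζ ^ Corner.tail.angle * (ζ ^ 7 * d))) := by
      simp only [Corner.angle]; push_cast; grind
    rw [e, Corner.combination_mem_interior hd']
    refine ⟨⟨?_, ?_⟩, ?_, ?_⟩ <;> nlinarith
  have he := hT.eq_of_mem_interior h.mem h' h1 h2
  rw [← square_eq, Corner.tile] at he
  have h3 := (square_inj (norm_zeta_pow_mul 5 hd') hd he).2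
  rw [← mul_assoc, ← pow_add] at h3
  have h5 : (2 : ℂ) * d = 0 := by grind
  simp [hd0] at h5

/-- The side of `T'` from `x` to `x + d` is diagonal at `x`, as seen from the tiles on both of its
sides. -/
structure IsDiagonalSide (T' : Set Tile) (x d : ℂ) : Prop where
  left : ∃ c, HasCorner T' x d c ∧ c.StartsDiagonal
  right : ∃ e c, HasCorner T' x e c ∧ c.EndsDiagonal ∧ ζ ^ c.angle * e = d

/-- The two tiles at a side agree about the end of the side at which the square is halved. -/
theorem startsDiagonal_iff {T' : Set Tile} (hT : IsTiling (inflate T')) {x e d : ℂ}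
    {c c' : Corner} (h : HasCorner T' x d c) (h' : HasCorner T' x e c')
    (hd : ζ ^ c'.angle * e = d) : c.StartsDiagonal ↔ c'.EndsDiagonal := by
  subst hd
  by_cases h1 : c.StartsDiagonal <;> by_cases h2 : c'.EndsDiagonal <;> simp only [h1, h2]
  · exact (not_opposite_squares hT (h.diagonal_start h1).1 (h'.unit_end h2).2).elim
  · exact (not_opposite_squares hT (h'.diagonal_end h2).1 (h.unit_start h1).2).elim

theorem HasCorner.isDiagonalSide_start {T' : Set Tile} (hT' : IsTiling T')
    (hT : IsTiling (inflate T')) {x d : ℂ} {c : Corner} (h : HasCorner T' x d c)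
    (hc : c.StartsDiagonal) : IsDiagonalSide T' x d := by
  obtain ⟨e, c', h', he⟩ := hT'.exists_cw h
  exact ⟨⟨c, h, hc⟩, e, c', h', (startsDiagonal_iff hT h h' he).1 hc, he⟩

theorem HasCorner.isDiagonalSide_end {T' : Set Tile} (hT' : IsTiling T')
    (hT : IsTiling (inflate T')) {x e : ℂ} {c : Corner} (h : HasCorner T' x e c)
    (hc : c.EndsDiagonal) : IsDiagonalSide T' x (ζ ^ c.angle * e) := by
  obtain ⟨c', h'⟩ := hT'.exists_ccw h
  exact ⟨⟨c', h', (startsDiagonal_iff hT h' h rfl).2 hc⟩, e, c, h, hc, rfl⟩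

namespace IsDiagonalSide

variable {T' : Set Tile} {x d : ℂ}

theorem norm_eq (h : IsDiagonalSide T' x d) : ‖d‖ = 1 :=
  let ⟨_, h, _⟩ := h.left
  h.norm_eq

theorem hasCorner_head (h : IsDiagonalSide T' x d) :
    HasCorner (inflate T') (silver * x) (ζ ^ 7 * d) .head :=
  let ⟨_, h, hc⟩ := h.left
  (h.diagonal_start hc).1

/-- The star of the tail of a halved square consists of this square and two obtuse corners of
rhombs, one in each of the adjacent supertiles. -/
theorem fan (h : IsDiagonalSide T' x d) :
    Fan (inflate T') (silver * x + (ζ + ζ ^ 7) * d) (ζ ^ 5 * d) [.obtuse, .obtuse, .tail] := by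
  have h4 := zeta_pow_four
  obtain ⟨c, h1, hc⟩ := h.left
  obtain ⟨e, c', h2, hc', he⟩ := h.right
  have h3 := (h2.diagonal_end hc').2
  rw [he] at h3
  refine ⟨h3, (h1.diagonal_start hc).2.cast rfl ?_,
    ⟨norm_zeta_pow_mul _ (norm_zeta_pow_mul _ (norm_zeta_pow_mul _ h.norm_eq)),
    square_congr h.hasCorner_head.mem ?_ ?_⟩, trivial⟩
  all_goals try simp only [Corner.angle]
  all_goals grind

theorem hasCorner_acute_left (h : IsDiagonalSide T' x d) :
    HasCorner (inflate T') (silver * x + ζ * d) (ζ ^ 7 * d) .acute := by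
  have h4 := zeta_pow_four
  obtain ⟨c, h1, hc⟩ := h.left
  exact (h1.diagonal_start hc).2.prev.cast (by simp only [Corner.angle]; grind)
    (by simp only [Corner.angle])

theorem hasCorner_acute_right (h : IsDiagonalSide T' x d) :
    HasCorner (inflate T') (silver * x + ζ ^ 7 * d) d .acute := by
  have h4 := zeta_pow_four
  obtain ⟨e, c', h2, hc', he⟩ := h.right
  have h3 := (h2.diagonal_end hc').2
  rw [he] at h3
  exact h3.next.cast (by grind) (by simp only [Corner.angle]; grind)

end IsDiagonalSide

theorem square_corners {T' : Set Tile} {p v : ℂ} (hv : ‖v‖ = 1) (h : square p v ∈ T') :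
    HasCorner T' p (ζ ^ 7 * v) .tail ∧ HasCorner T' (p + ζ * v) (ζ ^ 5 * v) .left ∧
      HasCorner T' (p + (ζ + ζ ^ 7) * v) (ζ ^ 3 * v) .head ∧
      HasCorner T' (p + ζ ^ 7 * v) (ζ * v) .right := by
  have h4 := zeta_pow_four
  refine ⟨⟨norm_zeta_pow_mul _ hv, square_congr h ?_ ?_⟩,
    ⟨norm_zeta_pow_mul _ hv, square_congr h ?_ ?_⟩,
    ⟨norm_zeta_pow_mul _ hv, square_congr h ?_ ?_⟩,
    ⟨norm_zeta_mul hv, square_congr h ?_ ?_⟩⟩ <;> grind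

theorem rhomb_corners {T' : Set Tile} {p v : ℂ} (hv : ‖v‖ = 1) (h : rhomb p v ∈ T') :
    HasCorner T' p v .acute ∧ HasCorner T' (p + v) (ζ * v) .obtuse ∧
      HasCorner T' (p + (1 + ζ) * v) (-v) .acute ∧
      HasCorner T' (p + ζ * v) (ζ ^ 5 * v) .obtuse := by
  have h4 := zeta_pow_four
  refine ⟨⟨hv, h⟩, ⟨norm_zeta_mul hv, rhomb_congr h ?_ ?_⟩,
    ⟨by simpa using hv, rhomb_congr_rotate h ?_ ?_⟩,
    ⟨norm_zeta_pow_mul _ hv, rhomb_congr_rotate h ?_ ?_⟩⟩ <;> grind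

theorem square_diagonalSides {T' : Set Tile} (hT' : IsTiling T') (hT : IsTiling (inflate T'))
    {p v : ℂ} (hv : ‖v‖ = 1) (h : square p v ∈ T') :
    IsDiagonalSide T' p (ζ * v) ∧ IsDiagonalSide T' p (ζ ^ 7 * v) ∧
      IsDiagonalSide T' (p + ζ * v) (ζ ^ 7 * v) ∧ IsDiagonalSide T' (p + ζ ^ 7 * v) (ζ * v) := by
  have h4 := zeta_pow_four
  obtain ⟨h1, h2, -, h3⟩ := square_corners hv h
  refine ⟨?_, h1.isDiagonalSide_start hT' hT trivial, ?_, h3.isDiagonalSide_start hT' hT trivial⟩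
  · convert h1.isDiagonalSide_end hT' hT trivial using 1
    simp only [Corner.angle]; grind
  · convert h2.isDiagonalSide_end hT' hT trivial using 1
    simp only [Corner.angle]; grind

theorem rhomb_diagonalSides {T' : Set Tile} (hT' : IsTiling T') (hT : IsTiling (inflate T'))
    {p v : ℂ} (hv : ‖v‖ = 1) (h : rhomb p v ∈ T') :
    IsDiagonalSide T' (p + v) (ζ ^ 4 * v) ∧ IsDiagonalSide T' (p + ζ * v) (ζ ^ 5 * v) ∧
      IsDiagonalSide T' (p + ζ * v) v ∧ IsDiagonalSide T' (p + v) (ζ * v) := by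
  have h4 := zeta_pow_four
  obtain ⟨-, h1, -, h2⟩ := rhomb_corners hv h
  refine ⟨?_, h2.isDiagonalSide_start hT' hT trivial, ?_, h1.isDiagonalSide_start hT' hT trivial⟩
  · convert h1.isDiagonalSide_end hT' hT trivial using 1
    simp only [Corner.angle]; grind
  · convert h2.isDiagonalSide_end hT' hT trivial using 1
    simp only [Corner.angle]; grind

/-- A tile of an inflated tiling is the inner square of the supertile of a square, a square that is
halved by an outline, one of the four rhombs in the supertile of a square, or one of the three
rhombs in the supertile of a rhomb. -/
theorem mem_inflate_cases {T' : Set Tile} (hT' : IsTiling T') (hT : IsTiling (inflate T'))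
    {t : Tile} (ht : t ∈ inflate T') :
    (∃ p v, ‖v‖ = 1 ∧ square p v ∈ T' ∧
      (t = square (silver * p + (1 + ζ + ζ ^ 7) * v) (ζ ^ 4 * v) ∨
      t = rhomb (silver * p + v) (ζ * v) ∨ t = rhomb (silver * p + v) (ζ ^ 6 * v) ∨
      t = rhomb (silver * p + (1 + ζ) * v) (ζ ^ 7 * v) ∨
      t = rhomb (silver * p + (1 + ζ ^ 7) * v) v)) ∨
    (∃ p v, ‖v‖ = 1 ∧ rhomb p v ∈ T' ∧
      (t = rhomb (silver * p) v ∨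
      t = rhomb (silver * p + (1 + ζ + ζ ^ 2) * v) (ζ ^ 6 * v) ∨
      t = rhomb (silver * p + (1 + ζ + ζ ^ 2 + ζ ^ 7) * v) v)) ∨
    ∃ x d, IsDiagonalSide T' x d ∧
      t = square (silver * x + (ζ + ζ ^ 7) * d) (-d) := by
  have h4 := zeta_pow_four
  have hl := silver_eq
  have key : ∀ {x d : ℂ}, IsDiagonalSide T' x d → ∀ q r,
      q = silver * x + (ζ + ζ ^ 7) * d → r = -d → ∃ x d, IsDiagonalSide T' x d ∧
      square q r = square (silver * x + (ζ + ζ ^ 7) * d) (-d) := by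
    rintro x d h q r rfl rfl; exact ⟨x, d, h, rfl⟩
  obtain ⟨s, hs, p, v, hv, ⟨rfl, ht⟩ | ⟨rfl, ht⟩⟩ := Set.mem_iUnion₂.1 ht
  · obtain ⟨d1, d2, d3, d4⟩ := square_diagonalSides hT' hT hv hs
    rcases ht with rfl | rfl | rfl | rfl | rfl | rfl | rfl | rfl | rfl
    · exact Or.inl ⟨p, v, hv, hs, Or.inl rfl⟩
    · exact Or.inr (Or.inr (key d1 _ _ (by grind) (by grind)))
    · exact Or.inr (Or.inr (key d2 _ _ (by grind) (by grind)))
    · exact Or.inr (Or.inr (key d3 _ _ (by grind) (by grind)))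
    · exact Or.inr (Or.inr (key d4 _ _ (by grind) (by grind)))
    all_goals exact Or.inl ⟨p, v, hv, hs, by simp only [true_or, or_true]⟩
  · obtain ⟨d1, d2, d3, d4⟩ := rhomb_diagonalSides hT' hT hv hs
    rcases ht with rfl | rfl | rfl | rfl | rfl | rfl | rfl
    · exact Or.inr (Or.inl ⟨p, v, hv, hs, Or.inl rfl⟩)
    · exact Or.inr (Or.inl ⟨p, v, hv, hs, Or.inr (Or.inl rfl)⟩)
    · exact Or.inr (Or.inl ⟨p, v, hv, hs, Or.inr (Or.inr rfl)⟩)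
    · exact Or.inr (Or.inr (key d1 _ _ (by grind) (by grind)))
    · exact Or.inr (Or.inr (key d2 _ _ (by grind) (by grind)))
    · exact Or.inr (Or.inr (key d3 _ _ (by grind) (by grind)))
    · exact Or.inr (Or.inr (key d4 _ _ (by grind) (by grind)))

/-- Every left or right corner of a square is also a corner of a rhomb. -/
def SideCornersMeetRhombs (T : Set Tile) : Prop :=
  ∀ x u c, HasCorner T x u c → c = .left ∨ c = .right → ∃ u' c', HasCorner T x u' c' ∧
    (c' = .acute ∨ c' = .obtuse)

/-- In an inflated tiling, a left or right corner of a square is also the acute corner of a rhomb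
from the same supertile, or from the adjacent one if the square is halved by an outline. -/
theorem sideCornersMeetRhombs_inflate {T' : Set Tile} (hT' : IsTiling T')
    (hT : IsTiling (inflate T')) : SideCornersMeetRhombs (inflate T') := by
  have h4 := zeta_pow_four
  have key : ∀ {q r : ℂ}, ‖r‖ = 1 → square q r ∈ inflate T' →
      (∃ u, HasCorner (inflate T') (q + ζ * r) u .acute) ∧
        ∃ u, HasCorner (inflate T') (q + ζ ^ 7 * r) u .acute := by
    intro q r hr h
    rcases mem_inflate_cases hT' hT h with ⟨p, v, hv, hp, h⟩ | ⟨p, v, hv, hp, h⟩ | ⟨x, d, hd, h⟩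
    · rcases h with h | h | h | h | h
      · obtain ⟨rfl, rfl⟩ := square_inj hr (norm_zeta_pow_mul _ hv) h
        obtain ⟨m1, m2, m3, m4, m5, m6, m7, m8, m9⟩ := square_inflate hv hp
        exact ⟨⟨_, hv, rhomb_congr m9 (by grind) rfl⟩,
          ⟨_, norm_zeta_pow_mul 7 hv, rhomb_congr m8 (by grind) rfl⟩⟩
      all_goals exact absurd h (square_ne_rhomb _ _ _ _)
    · rcases h with h | h | h <;> exact absurd h (square_ne_rhomb _ _ _ _)
    · obtain ⟨rfl, rfl⟩ := square_inj hr (by simpa using hd.norm_eq) h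
      exact ⟨⟨_, hd.hasCorner_acute_right.cast (by grind) rfl⟩,
        ⟨_, hd.hasCorner_acute_left.cast (by grind) rfl⟩⟩
  rintro x u c h (rfl | rfl)
  · obtain ⟨u', h'⟩ := (key (norm_zeta_pow_mul _ h.norm_eq) h.mem).1
    exact ⟨u', _, h'.cast (by grind) rfl, Or.inl rfl⟩
  · obtain ⟨u', h'⟩ := (key (norm_zeta_pow_mul _ h.norm_eq) h.mem).2
    exact ⟨u', _, h'.cast (by grind) rfl, Or.inl rfl⟩

/-! ### Degrees at the corners of the supertiles -/

theorem Fan.exists_of_mem {T : Set Tile} {x : ℂ} {c : Corner} {L : List Corner} : ∀ {u : ℂ},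
    Fan T x u L → c ∈ L → ∃ d, HasCorner T x d c := by
  induction L with
  | nil => intro u _ h; simp at h
  | cons c' L ih =>
    intro u h hc
    rcases List.mem_cons.1 hc with rfl | hc
    · exact ⟨u, h.1⟩
    · exact ih h.2 hc

theorem length_and_fanAngle_eq_count {L : List Corner} (h : ∀ c ∈ L, c.angle ≤ 2) :
    L.length = (L.map Corner.angle).count 1 + (L.map Corner.angle).count 2 ∧
      fanAngle L = (L.map Corner.angle).count 1 + 2 * (L.map Corner.angle).count 2 := by
  induction L with
  | nil => simp [fanAngle]
  | cons c L ih =>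
    obtain ⟨h1, h2⟩ := ih fun c' hc' => h c' (List.mem_cons_of_mem _ hc')
    have h3 := h c List.mem_cons_self
    have h4 := c.one_le_angle
    rw [fanAngle_cons, List.length_cons, List.map_cons, List.count_cons, List.count_cons]
    have : c.angle = 1 ∨ c.angle = 2 := by omega
    rcases this with h5 | h5 <;> simp [h5] <;> omega

/-- At a corner of a supertile there are only squares and acute corners of rhombs. -/
theorem angle_le_two_of_corner {T' : Set Tile} (hT' : IsTiling T') (hT : IsTiling (inflate T'))
    {x u d : ℂ} {c c' : Corner} (h : HasCorner T' x u c)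
    (h' : HasCorner (inflate T') (silver * x) d c') : c'.angle ≤ 2 := by
  obtain ⟨L, hL, h8⟩ := hT'.exists_fan h
  suffices hP : ∀ j, 8 ≤ j → j < 16 → ∃ i c', i ≤ j ∧ j < i + c'.angle ∧
      HasCorner (inflate T') (silver * x) (ζ ^ i * u) c' ∧ c'.angle ≤ 2 by
    obtain ⟨c'', h1, h2⟩ := hT.exists_of_sector_cover (P := fun _ c => c.angle ≤ 2) h.norm_eq hP h'
    rw [← h1]; exact h2
  intro j hj hj'
  have e8 : ζ ^ 8 = 1 := zeta_pow_eq_one.2 dvd_rfl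
  have h4 := zeta_pow_four
  obtain ⟨i, c, h1, h2, h3, -⟩ := hL.exists_cover (j := j - 8) (by omega)
  obtain ⟨o, ho⟩ : ∃ o, j = i + o + 8 := ⟨j - 8 - i, by omega⟩
  subst ho
  have hoc : o < c.angle := by omega
  by_cases ho : o = 0
  · -- the sector along the first side
    subst ho
    by_cases hc : c.StartsDiagonal
    · refine ⟨i + 7, .head, by omega, by simp only [Corner.angle]; omega,
        (h3.diagonal_start hc).1.cast rfl (by ring), le_rfl⟩
    · refine ⟨i + 8, .acute, by omega, by simp only [Corner.angle]; omega,
        (h3.unit_start hc).1.cast rfl (by rw [pow_add, e8, mul_one]), by simp [Corner.angle]⟩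
  by_cases ho' : o + 1 = c.angle
  · -- the sector along the second side
    by_cases hc : c.EndsDiagonal
    · refine ⟨i + o + 8, .head, by omega, by simp only [Corner.angle]; omega,
        (h3.diagonal_end hc).1.cast rfl ?_, le_rfl⟩
      rw [← ho']; ring
    · refine ⟨i + o + 8, .acute, by omega, by simp only [Corner.angle]; omega,
        (h3.unit_end hc).1.cast rfl ?_, by simp [Corner.angle]⟩
      rw [← ho']; ring
  -- the middle sector of an obtuse corner
  have hc3 := c.angle_le_three
  obtain rfl : o = 1 := by omega
  have hc : c = .obtuse := by cases c <;> simp [Corner.angle] at ho' hoc ⊢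
  subst hc
  exact ⟨i + 9, .acute, by omega, by simp only [Corner.angle]; omega,
    h3.obtuse_middle.cast rfl (by rw [show i + 9 = i + 1 + 8 by rfl, pow_add, e8]; ring),
    by simp [Corner.angle]⟩

/-- A rhomb of `T'` at `x` gives an acute corner of the inflated tiling at `λ x` that begins inside
the angle of this rhomb. -/
theorem exists_acute_of_rhomb {T' : Set Tile} {x d : ℂ} {c : Corner} (h : HasCorner T' x d c)
    (hc : c = .acute ∨ c = .obtuse) : ∃ i < c.angle,
      HasCorner (inflate T') (silver * x) (ζ ^ i * d) .acute := by
  rcases hc with rfl | rfl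
  · exact ⟨0, by simp [Corner.angle], (h.unit_start (fun h => h)).1.cast rfl (by simp)⟩
  · exact ⟨1, by simp [Corner.angle], h.obtuse_middle.cast rfl (by simp)⟩

/-- Angles of different sizes at the same vertex share no sector. -/
theorem not_overlap {T : Set Tile} (hT : IsTiling T) {x d e : ℂ} {c c' : Corner} {i j : ℕ}
    (h : HasCorner T x d c) (h' : HasCorner T x e c') (hne : c.angle ≠ c'.angle)
    (hi : i < c.angle) (hj : j < c'.angle) : ζ ^ i * d ≠ ζ ^ j * e := by
  intro heq
  have key : ∀ {d e : ℂ} {c c' : Corner} {i j : ℕ}, HasCorner T x d c → HasCorner T x e c' →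
      c.angle ≠ c'.angle → i < c.angle → j ≤ i → ζ ^ i * d ≠ ζ ^ j * e := by
    intro d e c c' i j h h' hne hi hji heq
    have he : e = ζ ^ (i - j) * d := by
      have h0 : ζ ^ j ≠ 0 := pow_ne_zero _ zeta_ne_zero
      apply mul_left_cancel₀ h0
      rw [← heq, ← mul_assoc, ← pow_add, Nat.add_sub_cancel' hji]
    exact hne (hT.overlap h (h'.cast rfl he) (by omega)).2
  rcases le_total j i with hji | hij
  · exact key h h' hne hi hji heq
  · exact key h' h hne.symm hj hij heq.symm

theorem card_three {u : ℂ} (hu : ‖u‖ = 1) {i j k : ℕ} (hij : i < j) (hjk : j < k)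
    (hk : k < i + 8) : ({ζ ^ i * u, ζ ^ j * u, ζ ^ k * u} : Finset ℂ).card = 3 := by
  apply Finset.card_eq_three.2
  refine ⟨_, _, _, ?_, ?_, ?_, rfl⟩ <;> intro h
  · have := zeta_pow_inj hu hij.le (by omega) h; omega
  · have := zeta_pow_inj hu (by omega) (by omega) h; omega
  · have := zeta_pow_inj hu hjk.le (by omega) h; omega

/-- At the left or right corner of a square of `T'` there are at least three acute corners of
rhombs of the inflated tiling: one in each of the two supertiles at the unit side of the square,
and a third one in the second of these or in the next one.  The third one is missing if the second
supertile comes from a side corner of a square as well; then a rhomb of `T'` at the same vertex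
provides it. -/
theorem exists_three_acute {T' : Set Tile} (hT' : IsTiling T') (hT : IsTiling (inflate T'))
    (hr : SideCornersMeetRhombs T') {x u : ℂ} {c : Corner} (h : HasCorner T' x u c)
    (hc : c = .left ∨ c = .right) : ∃ S : Finset ℂ, S.card = 3 ∧
      ∀ d ∈ S, HasCorner (inflate T') (silver * x) d .acute := by
  have hu := h.norm_eq
  obtain ⟨d, r, hd, hrr⟩ := hr x u c h hc
  obtain ⟨m, hm, ha⟩ := exists_acute_of_rhomb hd hrr
  have hr2 : r.angle ≠ 2 := by rcases hrr with rfl | rfl <;> simp [Corner.angle]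
  have e8 : ζ ^ 8 = 1 := zeta_pow_eq_one.2 dvd_rfl
  rcases hc with rfl | rfl
  · -- the acute corner at the unit side `u` of the square, and the next ones clockwise
    have a1 := (h.unit_start (fun h => h)).1
    obtain ⟨e, c', h', he⟩ := hT'.exists_cw h
    have hc' : ¬ c'.EndsDiagonal := fun hh => (startsDiagonal_iff hT h h' he).2 hh
    have a2 := (h'.unit_end hc').1
    rw [he] at a2
    have hcard := card_three hu (i := 6) (j := 7) (k := 8) (by omega) (by omega) (by omega)
    rw [e8, one_mul] at hcard
    by_cases hs : c'.StartsDiagonal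
    · have hc'' : c' = .right := by
        cases c' <;> simp [Corner.StartsDiagonal, Corner.EndsDiagonal] at hs hc' ⊢
      subst hc''
      have n1 : ζ ^ m * d ≠ u := by
        simpa using not_overlap hT' hd h (j := 0) hr2 hm (by simp [Corner.angle])
      have n2 : ζ ^ m * d ≠ ζ ^ 7 * u := by
        rw [← he]
        have := not_overlap hT' hd h' (j := 1) hr2 hm (by simp [Corner.angle])
        convert this using 1
        simp only [Corner.angle]; grind
      refine ⟨{ζ ^ m * d, ζ ^ 7 * u, u}, Finset.card_eq_three.2 ⟨_, _, _, n2, n1, ?_, rfl⟩, ?_⟩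
      · intro h7
        have := zeta_pow_inj (i := 0) (j := 7) hu (by omega) (by omega) (by simpa using h7.symm)
        omega
      · simp only [Finset.mem_insert, Finset.mem_singleton]
        rintro y (rfl | rfl | rfl)
        exacts [ha, a2, a1]
    · have a3 : HasCorner (inflate T') (silver * x) (ζ ^ 6 * u) .acute := by
        have h5 := (h'.unit_start hs).1
        cases c' <;> simp only [Corner.StartsDiagonal, Corner.EndsDiagonal, not_true_eq_false]
          at hs hc'
        · obtain ⟨f, c'', h'', hf⟩ := hT'.exists_cw h'
          have hc'' : ¬ c''.EndsDiagonal := fun hh => (startsDiagonal_iff hT h' h'' hf).2 hh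
          refine (h''.unit_end hc'').1.cast rfl ?_
          rw [hf, ← he]; simp only [Corner.angle]; grind
        · refine h5.cast rfl ?_
          rw [← he]; simp only [Corner.angle]; grind
      refine ⟨_, hcard, ?_⟩
      simp only [Finset.mem_insert, Finset.mem_singleton]
      rintro y (rfl | rfl | rfl)
      exacts [a3, a2, a1]
  · -- the mirror image
    have a1 : HasCorner (inflate T') (silver * x) (ζ ^ 1 * u) .acute :=
      (h.unit_end (fun h => h)).1.cast rfl (by simp only [Corner.angle]; grind)
    obtain ⟨c', h'⟩ := hT'.exists_ccw h
    have hc' : ¬ c'.StartsDiagonal := fun hh => (startsDiagonal_iff hT h' h rfl).1 hh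
    have a2 := (h'.unit_start hc').1
    simp only [Corner.angle] at a2
    have hcard := card_three hu (i := 1) (j := 2) (k := 3) (by omega) (by omega) (by omega)
    by_cases hs : c'.EndsDiagonal
    · have hc'' : c' = .left := by
        cases c' <;> simp [Corner.StartsDiagonal, Corner.EndsDiagonal] at hs hc' ⊢
      subst hc''
      have n1 : ζ ^ m * d ≠ ζ ^ 1 * u :=
        not_overlap hT' hd h (j := 1) hr2 hm (by simp [Corner.angle])
      have n2 : ζ ^ m * d ≠ ζ ^ 2 * u := by
        simpa [Corner.angle] using not_overlap hT' hd h' (j := 0) hr2 hm (by simp [Corner.angle])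
      refine ⟨{ζ ^ m * d, ζ ^ 1 * u, ζ ^ 2 * u},
        Finset.card_eq_three.2 ⟨_, _, _, n1, n2, ?_, rfl⟩, ?_⟩
      · intro h7
        have := zeta_pow_inj hu (by omega) (by omega) h7
        omega
      · simp only [Finset.mem_insert, Finset.mem_singleton]
        rintro y (rfl | rfl | rfl)
        exacts [ha, a1, a2]
    · have a3 : HasCorner (inflate T') (silver * x) (ζ ^ 3 * u) .acute := by
        have h5 := (h'.unit_end hs).1
        cases c' <;> simp only [Corner.StartsDiagonal, Corner.EndsDiagonal, not_true_eq_false]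
          at hs hc'
        · obtain ⟨c'', h''⟩ := hT'.exists_ccw h'
          have hc'' : ¬ c''.StartsDiagonal := fun hh => (startsDiagonal_iff hT h'' h' rfl).1 hh
          refine (h''.unit_start hc'').1.cast rfl ?_
          simp only [Corner.angle]; grind
        · refine h5.cast rfl ?_
          simp only [Corner.angle]; grind
      refine ⟨_, hcard, ?_⟩
      simp only [Finset.mem_insert, Finset.mem_singleton]
      rintro y (rfl | rfl | rfl)
      exacts [a1, a2, a3]

/-- The star of a corner of a supertile, and the values that its degree avoids: if the star has `a`
acute corners and `b` corners of squares, then `a + 2 * b = 8`, so the degree is `4 + a / 2`. -/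
theorem exists_corner_fan {T' : Set Tile} (hT' : IsTiling T') (hT : IsTiling (inflate T'))
    (hr : SideCornersMeetRhombs T') {x u : ℂ} {c : Corner} (h : HasCorner T' x u c) :
    ∃ u₀ L, ‖u₀‖ = 1 ∧ Fan (inflate T') (silver * x) u₀ L ∧ fanAngle L = 8 ∧ L.length ≠ 3 ∧
      (c = .obtuse → L.length ≠ 4) ∧ (c = .tail → L.length ≠ 7) ∧
      (c = .left ∨ c = .right → L.length ≠ 5) := by
  have hu := h.norm_eq
  have h4 := zeta_pow_four
  obtain ⟨u₀, c₀, h₀⟩ : ∃ u₀ c₀, HasCorner (inflate T') (silver * x) u₀ c₀ := by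
    by_cases hc : c.StartsDiagonal
    · exact ⟨_, _, (h.diagonal_start hc).1⟩
    · exact ⟨_, _, (h.unit_start hc).1⟩
  obtain ⟨L, hL, h8⟩ := hT.exists_fan h₀
  obtain ⟨hlen, hang⟩ := length_and_fanAngle_eq_count (L := L) fun c hc =>
    let ⟨d, hd⟩ := hL.exists_of_mem hc
    angle_le_two_of_corner hT' hT h hd
  refine ⟨u₀, L, h₀.norm_eq, hL, h8, by omega, ?_, ?_, ?_⟩
  · rintro rfl
    have := hT.card_le_count_angle h₀.norm_eq hL h8 (k := 1) {ζ * u} (by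
      simpa using ⟨Corner.acute, rfl, h.obtuse_middle⟩)
    rw [Finset.card_singleton] at this
    omega
  · rintro rfl
    have hne : ζ ^ 7 * u ≠ ζ ^ 1 * u := by
      intro h1
      have := zeta_pow_inj hu (i := 1) (j := 7) (by omega) (by omega) h1.symm
      omega
    have h1 := (h.diagonal_start trivial).1
    have h2 : HasCorner (inflate T') (silver * x) (ζ ^ 1 * u) .head :=
      (h.diagonal_end trivial).1.cast rfl (by simp only [Corner.angle]; grind)
    have := hT.card_le_count_angle h₀.norm_eq hL h8 (k := 2) {ζ ^ 7 * u, ζ ^ 1 * u} (by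
      simp only [Finset.mem_insert, Finset.mem_singleton]
      rintro d (rfl | rfl)
      exacts [⟨_, rfl, h1⟩, ⟨_, rfl, h2⟩])
    rw [Finset.card_pair hne] at this
    omega
  · intro hc
    obtain ⟨S, hS, hS'⟩ := exists_three_acute hT' hT hr h hc
    have := hT.card_le_count_angle h₀.norm_eq hL h8 (k := 1) S fun d hd => ⟨_, rfl, hS' d hd⟩
    omega

/-! ### The outlines -/

theorem mem_outline {T' : Set Tile} {x d : ℂ} {c : Corner} (h : HasCorner T' x d c) {s : ℝ}
    (h0 : 0 ≤ s) (h1 : s ≤ 1) : silver * (x + s * d) ∈ outline T' := by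
  refine ⟨_, h.mem, x, x + d, by rw [c.tile_sides]; simp, 1 - s, s, by linarith, h0, by ring, ?_⟩
  simp only [Complex.real_smul]; push_cast; ring

theorem corner_mem_outline {T' : Set Tile} {x d : ℂ} {c : Corner} (h : HasCorner T' x d c) :
    silver * x ∈ outline T' := by
  simpa using mem_outline h (s := 0) le_rfl zero_le_one

theorem silver_ne_zero : silver ≠ 0 := by
  intro h
  have h2 : (1 : ℂ) = Real.sqrt 2 * (-1) := by unfold silver at h; linear_combination h
  have h3 := congrArg (· ^ 2) h2
  simp only [mul_pow, sqrt_two_sq] at h3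
  norm_num at h3

theorem IsDiagonalSide.mem_outline {T' : Set Tile} {x d : ℂ} (h : IsDiagonalSide T' x d) :
    silver * x + (ζ + ζ ^ 7) * d ∈ outline T' := by
  obtain ⟨c, h, -⟩ := h.left
  have hs : 0 ≤ Real.sqrt 2 := by positivity
  have hC := sqrt_two_eq
  have h4 := zeta_pow_four
  have h1 := AmmannBeenker.mem_outline h (s := Real.sqrt 2 / (1 + Real.sqrt 2)) (by positivity)
    (by rw [div_le_one (by positivity)]; linarith)
  convert h1 using 1
  have h2 := silver_ne_zero
  push_cast
  rw [← silver]
  field_simp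
  grind

/-- The outlines avoid the interiors of the supertiles. -/
theorem notMem_outline {T' : Set Tile} (hT' : IsTiling T') {t : Tile} (ht : t ∈ T') {z : ℂ}
    (hz : z ∈ interior t.region) : silver * z ∉ outline T' := by
  rintro ⟨t', ht', a, b, hab, α, β, hα, hβ, h1, h2⟩
  have key : ∃ c, HasCorner T' a (b - a) c := by
    rw [← graph_adj_iff hT']
    refine ⟨?_, t', ht', hab⟩
    rintro rfl
    obtain ⟨x, u, c, hu, rfl⟩ := hT'.exists_corner ht'
    have hu0 : u ≠ 0 := by intro h; simp [h] at hu
    rw [c.tile_sides] at hab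
    simp only [Set.mem_insert_iff, Set.mem_singleton_iff, Sym2.eq_iff] at hab
    have hk : ζ ^ c.angle * u ≠ 0 := mul_ne_zero (pow_ne_zero _ zeta_ne_zero) hu0
    grind
  obtain ⟨c, h⟩ := key
  refine hT'.side_notMem_interior h ht hβ (by linarith) ?_
  convert hz using 1
  apply mul_left_cancel₀ silver_ne_zero
  rw [← h2]
  simp only [Complex.real_smul]
  obtain rfl : α = 1 - β := by linarith
  push_cast; ring

theorem mem_interior_square {p v : ℂ} (hv : ‖v‖ = 1) {a b : ℝ} (ha : a ∈ Set.Ioo (0 : ℝ) 1)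
    (hb : b ∈ Set.Ioo (0 : ℝ) 1) :
    p + (a * (ζ ^ 7 * v) + b * (ζ * v)) ∈ interior (square p v).region := by
  have h := (Corner.tail.combination_mem_interior (x := p) (norm_zeta_pow_mul 7 hv)).2 ⟨ha, hb⟩
  rw [square_eq]
  convert h using 4
  simp only [Corner.angle]; grind [zeta_pow_four]

/-- The corners of the inner square lie inside the outline of the supertile of a square. -/
theorem innerSquare_interior {p v q : ℂ} (hv : ‖v‖ = 1)
    (hq : q = 1 ∨ q = 1 + ζ ∨ q = 1 + ζ ^ 7 ∨ q = 1 + ζ + ζ ^ 7) :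
    ∃ z ∈ interior (square p v).region, silver * p + q * v = silver * z := by
  have hs : (Real.sqrt 2) ^ 2 = 2 := Real.sq_sqrt (by norm_num)
  have hs0 : 0 < Real.sqrt 2 := by positivity
  have hC := sqrt_two_eq
  have hC2 := sqrt_two_sq
  have hl := silver_eq
  have h4 := zeta_pow_four
  have h1 : 1 - Real.sqrt 2 / 2 ∈ Set.Ioo (0 : ℝ) 1 := ⟨by nlinarith, by linarith⟩
  have h2 : Real.sqrt 2 / 2 ∈ Set.Ioo (0 : ℝ) 1 := ⟨by linarith, by nlinarith⟩
  rcases hq with rfl | rfl | rfl | rfl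
  · refine ⟨_, mem_interior_square hv h1 h1, ?_⟩; push_cast; grind
  · refine ⟨_, mem_interior_square hv h1 h2, ?_⟩; push_cast; grind
  · refine ⟨_, mem_interior_square hv h2 h1, ?_⟩; push_cast; grind
  · refine ⟨_, mem_interior_square hv h2 h2, ?_⟩; push_cast; grind

theorem innerSquare_notMem_outline {T' : Set Tile} (hT' : IsTiling T') {p v q : ℂ} (hv : ‖v‖ = 1)
    (h : square p v ∈ T') (hq : q = 1 ∨ q = 1 + ζ ∨ q = 1 + ζ ^ 7 ∨ q = 1 + ζ + ζ ^ 7) :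
    silver * p + q * v ∉ outline T' := by
  obtain ⟨z, hz, e⟩ := innerSquare_interior (p := p) hv hq
  rw [e]
  exact notMem_outline hT' h hz

/-! ### Consistency of the rule -/

/-- The edges that the rule gives weight `2`: the sides of the inner squares at the heads of their
arrows. -/
def heavyEdges (T' : Set Tile) : Set (Sym2 ℂ) :=
  {e | ∃ p v, ‖v‖ = 1 ∧ square p v ∈ T' ∧
    (e = s(silver * p + v, silver * p + (1 + ζ) * v) ∨
      e = s(silver * p + v, silver * p + (1 + ζ ^ 7) * v))}

theorem exists_of_mem_heavyEdges {T' : Set Tile} {e : Sym2 ℂ} (h : e ∈ heavyEdges T') {x : ℂ}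
    (hx : x ∈ e) : ∃ p v q, ‖v‖ = 1 ∧ square p v ∈ T' ∧ x = silver * p + q * v ∧
      (q = 1 ∨ q = 1 + ζ ∨ q = 1 + ζ ^ 7) := by
  obtain ⟨p, v, hv, hp, rfl | rfl⟩ := h <;> rcases Sym2.mem_iff.1 hx with rfl | rfl
  · exact ⟨p, v, 1, hv, hp, by ring, Or.inl rfl⟩
  · exact ⟨p, v, _, hv, hp, rfl, Or.inr (Or.inl rfl)⟩
  · exact ⟨p, v, 1, hv, hp, by ring, Or.inl rfl⟩
  · exact ⟨p, v, _, hv, hp, rfl, Or.inr (Or.inr rfl)⟩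

/-- The edges at the tail of the arrow of an inner square are not given weight `2` on account of
another supertile, because the interiors of supertiles are disjoint. -/
theorem tail_innerSquare_notMem {T' : Set Tile} (hT' : IsTiling T') {p v : ℂ} (hv : ‖v‖ = 1)
    (h : square p v ∈ T') {e : Sym2 ℂ} (he : silver * p + (1 + ζ + ζ ^ 7) * v ∈ e) :
    e ∉ heavyEdges T' := by
  intro hh
  obtain ⟨p', v', q, hv', hp', hx, hq⟩ := exists_of_mem_heavyEdges hh he
  obtain ⟨z, hz, e1⟩ := innerSquare_interior (p := p) hv (Or.inr (Or.inr (Or.inr rfl)))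
  obtain ⟨z', hz', e2⟩ := innerSquare_interior (p := p') (q := q) hv' (by tauto)
  rw [e1, e2] at hx
  obtain rfl := mul_left_cancel₀ silver_ne_zero hx
  obtain ⟨rfl, rfl⟩ := square_inj hv hv' (hT'.eq_of_mem_interior h hp' hz hz')
  have hv0 : v ≠ 0 := by intro h; simp [h] at hv
  have hqq := mul_right_cancel₀ hv0 (add_left_cancel (e1.trans e2.symm))
  have h4 := zeta_pow_four
  have h0 := zeta_ne_zero
  rcases hq with rfl | rfl | rfl
  · have h1 : ζ ^ 2 = 1 := by grind
    rw [show ζ ^ 4 = (ζ ^ 2) ^ 2 by ring, h1] at h4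
    norm_num at h4
  · have : ζ ^ 7 = 0 := by linear_combination hqq
    exact pow_ne_zero _ h0 this
  · exact h0 (by linear_combination hqq)

theorem exists_isWeighting {T' : Set Tile} (hT' : IsTiling T') (T : Set Tile) :
    ∃ w, IsWeighting T T' w := by
  classical
  refine ⟨fun e => if e ∈ heavyEdges T' then 2 else 1, ?_, ?_⟩
  · rintro e - ⟨x, hx, ho⟩
    refine if_neg fun hh => ?_
    obtain ⟨p, v, q, hv, hp, rfl, hq⟩ := exists_of_mem_heavyEdges hh hx
    exact innerSquare_notMem_outline hT' hv hp (by tauto) ho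
  · intro p v hv hp
    exact ⟨if_pos ⟨p, v, hv, hp, Or.inl rfl⟩, if_pos ⟨p, v, hv, hp, Or.inr rfl⟩,
      if_neg (tail_innerSquare_notMem hT' hv hp (Sym2.mem_mk_left _ _)),
      if_neg (tail_innerSquare_notMem hT' hv hp (Sym2.mem_mk_left _ _))⟩

/-! ### Weighted degrees -/

theorem IsWeighting.eq_one {T T' : Set Tile} {w : Sym2 ℂ → ℕ} (hw : IsWeighting T T' w)
    (hT : IsTiling T) {x d : ℂ} {c : Corner} (h : HasCorner T x d c)
    (ho : x ∈ outline T' ∨ x + d ∈ outline T') : w s(x, x + d) = 1 := by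
  refine hw.external _ ?_ ?_
  · rw [SimpleGraph.mem_edgeSet, graph_adj_iff hT]
    exact ⟨c, h.cast rfl (by ring)⟩
  · rcases ho with ho | ho
    · exact ⟨x, Sym2.mem_mk_left _ _, ho⟩
    · exact ⟨x + d, Sym2.mem_mk_right _ _, ho⟩

theorem IsWeighting.eq_one_of_mem {T T' : Set Tile} {w : Sym2 ℂ → ℕ} (hw : IsWeighting T T' w)
    (hT : IsTiling T) {x d y : ℂ} {c : Corner} (h : HasCorner T x d c) (ho : y ∈ outline T')
    (hy : x + d = y) : w s(x, x + d) = 1 :=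
  hw.eq_one hT h (Or.inr (hy ▸ ho))

/-- At an external vertex all edges have weight `1`, so its weighted degree is its degree. -/
theorem IsWeighting.weightedDegree_outline {T T' : Set Tile} {w : Sym2 ℂ → ℕ}
    (hw : IsWeighting T T' w) (hT : IsTiling T) {x u : ℂ} {L : List Corner} (hu : ‖u‖ = 1)
    (hL : Fan T x u L) (h8 : fanAngle L = 8) (ho : x ∈ outline T') :
    weightedDegree (graph T) w x = L.length := by
  rw [hT.weightedDegree_eq w hu hL h8]
  have h1 : ∀ n ∈ (fanSides u L).map (fun d => w s(x, x + d)), n = 1 := by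
    intro n hn
    obtain ⟨d, hd, rfl⟩ := List.mem_map.1 hn
    obtain ⟨c, hc⟩ := hL.hasCorner hd
    exact hw.eq_one hT hc (Or.inl ho)
  have h2 : (fanSides u L).length = L.length := by
    clear hL h8 h1 hu
    induction L generalizing u with
    | nil => rfl
    | cons c L ih => simp [fanSides_cons, ih]
  rw [List.eq_replicate_of_mem h1]
  simp [h2]

section

variable {T' : Set Tile} {w : Sym2 ℂ → ℕ}

/-- The weighted degree at the tail of a halved square. -/
theorem IsDiagonalSide.weightedDegree_eq {x d : ℂ} (h : IsDiagonalSide T' x d)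
    (hT : IsTiling (inflate T')) (hw : IsWeighting (inflate T') T' w) :
    weightedDegree (graph (inflate T')) w (silver * x + (ζ + ζ ^ 7) * d) = 3 :=
  hw.weightedDegree_outline hT (norm_zeta_pow_mul _ h.norm_eq) h.fan rfl h.mem_outline

/-- The weighted degree at a corner of a supertile differs from the weighted degrees of the
vertices to which it can be adjacent. -/
theorem weightedDegree_corner (hT' : IsTiling T') (hT : IsTiling (inflate T'))
    (hr : SideCornersMeetRhombs T') (hw : IsWeighting (inflate T') T' w) {x u : ℂ} {c : Corner}
    (h : HasCorner T' x u c) :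
    weightedDegree (graph (inflate T')) w (silver * x) ≠ 3 ∧
      (c = .obtuse → weightedDegree (graph (inflate T')) w (silver * x) ≠ 4) ∧
      (c = .tail → weightedDegree (graph (inflate T')) w (silver * x) ≠ 7) ∧
      (c = .left ∨ c = .right → weightedDegree (graph (inflate T')) w (silver * x) ≠ 5) := by
  obtain ⟨u₀, L, hu₀, hL, h8, h1⟩ := exists_corner_fan hT' hT hr h
  rw [hw.weightedDegree_outline hT hu₀ hL h8 (corner_mem_outline h)]
  exact h1

/-- The outline vertices of the supertile of a square, other than its corners. -/
theorem square_outline (hT' : IsTiling T') (hT : IsTiling (inflate T')) {p v : ℂ} (hv : ‖v‖ = 1)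
    (h : square p v ∈ T') :
    silver * p + (1 + ζ ^ 2) * v ∈ outline T' ∧ silver * p + (1 + ζ ^ 6) * v ∈ outline T' ∧
      silver * p + (2 + ζ) * v ∈ outline T' ∧ silver * p + (2 + ζ ^ 7) * v ∈ outline T' := by
  have h4 := zeta_pow_four
  have hl := silver_eq
  obtain ⟨d1, d2, d3, d4⟩ := square_diagonalSides hT' hT hv h
  have e1 := d1.mem_outline
  have e2 := d2.mem_outline
  have e3 := d3.mem_outline
  have e4 := d4.mem_outline
  refine ⟨?_, ?_, ?_, ?_⟩
  · convert e1 using 1; grind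
  · convert e2 using 1; grind
  · convert e3 using 1; grind
  · convert e4 using 1; grind

/-- The outline vertices of the supertile of a rhomb, other than its corners. -/
theorem rhomb_outline (hT' : IsTiling T') (hT : IsTiling (inflate T')) {p v : ℂ} (hv : ‖v‖ = 1)
    (h : rhomb p v ∈ T') :
    silver * p + v ∈ outline T' ∧ silver * p + ζ * v ∈ outline T' ∧
      silver * p + (1 + 2 * ζ + ζ ^ 2 + ζ ^ 7) * v ∈ outline T' ∧
      silver * p + (2 + ζ + ζ ^ 2 + ζ ^ 7) * v ∈ outline T' := by
  have h4 := zeta_pow_four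
  have hl := silver_eq
  obtain ⟨d1, d2, d3, d4⟩ := rhomb_diagonalSides hT' hT hv h
  have e1 := d1.mem_outline
  have e2 := d2.mem_outline
  have e3 := d3.mem_outline
  have e4 := d4.mem_outline
  refine ⟨?_, ?_, ?_, ?_⟩
  · convert e1 using 1; grind
  · convert e2 using 1; grind
  · convert e3 using 1; grind
  · convert e4 using 1; grind

/-- The weighted degree at the head of the inner square in the supertile of a square. -/
theorem weightedDegree_square_head (hT' : IsTiling T') (hT : IsTiling (inflate T'))
    (hw : IsWeighting (inflate T') T' w) {p v : ℂ} (hv : ‖v‖ = 1) (h : square p v ∈ T') :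
    weightedDegree (graph (inflate T')) w (silver * p + v) = 7 := by
  have h4 := zeta_pow_four
  have hl := silver_eq
  obtain ⟨m1, m2, m3, m4, m5, m6, m7, m8, m9⟩ := square_inflate hv h
  obtain ⟨o1, o2, o3, o4⟩ := square_outline hT' hT hv h
  obtain ⟨k1, k2, k3, k4⟩ := square_corners hv h
  obtain ⟨w1, w2, w3, w4⟩ := hw.internal p v hv h
  have c1 : HasCorner (inflate T') (silver * p + v) (ζ * v) .acute :=
    ⟨norm_zeta_mul hv, rhomb_congr m6 (by grind) (by grind)⟩
  have c2 : HasCorner (inflate T') (silver * p + v) (ζ ^ 2 * v) .left :=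
    ⟨norm_zeta_pow_mul _ hv, square_congr m2 (by grind) (by grind)⟩
  have c3 : HasCorner (inflate T') (silver * p + v) (ζ ^ 4 * v) .right :=
    ⟨norm_zeta_pow_mul _ hv, square_congr m3 (by grind) (by grind)⟩
  have c4 : HasCorner (inflate T') (silver * p + v) (ζ ^ 6 * v) .acute :=
    ⟨norm_zeta_pow_mul _ hv, rhomb_congr m7 (by grind) (by grind)⟩
  have c5 : HasCorner (inflate T') (silver * p + v) (ζ ^ 7 * v) .head :=
    ⟨norm_zeta_pow_mul _ hv, square_congr m1 (by grind) (by grind)⟩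
  have f : Fan (inflate T') (silver * p + v) (ζ * v)
      [.acute, .left, .right, .acute, .head] :=
    ⟨c1, c2.cast rfl (by simp only [Corner.angle]; ring),
      c3.cast rfl (by simp only [Corner.angle]; ring),
      c4.cast rfl (by simp only [Corner.angle]; ring),
      c5.cast rfl (by simp only [Corner.angle]; ring), trivial⟩
  have hs : fanSides (ζ * v) [.acute, .left, .right, .acute, .head] =
      [ζ * v, ζ ^ 2 * v, ζ ^ 4 * v, ζ ^ 6 * v, ζ ^ 7 * v] := by
    simp only [fanSides_cons, fanSides_nil, Corner.angle, List.cons.injEq, and_true, true_and]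
    grind
  have e1 : w s(silver * p + v,
      silver * p + v + ζ * v) = 2 := by
    rw [show silver * p + v + ζ * v =
      silver * p + (1 + ζ) * v by grind]
    exact w1
  have e2 := hw.eq_one_of_mem hT c2 o1 (by grind)
  have e3 := hw.eq_one_of_mem hT c3 (corner_mem_outline k1) (by grind)
  have e4 := hw.eq_one_of_mem hT c4 o2 (by grind)
  have e5 : w s(silver * p + v,
      silver * p + v + ζ ^ 7 * v) = 2 := by
    rw [show silver * p + v + ζ ^ 7 * v =
      silver * p + (1 + ζ ^ 7) * v by grind]
    exact w2
  rw [hT.weightedDegree_eq w (norm_zeta_mul hv) f rfl, hs]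
  simp only [List.map_cons, List.map_nil,
    List.sum_cons, List.sum_nil, Nat.reduceAdd, e1, e2, e3, e4, e5]

/-- The weighted degree at the right corner of the inner square in the supertile of a square. -/
theorem weightedDegree_square_right (hT' : IsTiling T') (hT : IsTiling (inflate T'))
    (hw : IsWeighting (inflate T') T' w) {p v : ℂ} (hv : ‖v‖ = 1) (h : square p v ∈ T') :
    weightedDegree (graph (inflate T')) w (silver * p + (1 + ζ) * v) = 5 := by
  have h4 := zeta_pow_four
  have hl := silver_eq
  obtain ⟨m1, m2, m3, m4, m5, m6, m7, m8, m9⟩ := square_inflate hv h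
  obtain ⟨o1, o2, o3, o4⟩ := square_outline hT' hT hv h
  obtain ⟨k1, k2, k3, k4⟩ := square_corners hv h
  obtain ⟨w1, w2, w3, w4⟩ := hw.internal p v hv h
  have c1 : HasCorner (inflate T') (silver * p + (1 + ζ) * v) v .left :=
    ⟨hv, square_congr m4 (by grind) (by grind)⟩
  have c2 : HasCorner (inflate T') (silver * p + (1 + ζ) * v) (ζ ^ 2 * v) .obtuse :=
    ⟨norm_zeta_pow_mul _ hv, rhomb_congr m6 (by grind) (by grind)⟩
  have c3 : HasCorner (inflate T') (silver * p + (1 + ζ) * v) (ζ ^ 5 * v) .right :=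
    ⟨norm_zeta_pow_mul _ hv, square_congr m1 (by grind) (by grind)⟩
  have c4 : HasCorner (inflate T') (silver * p + (1 + ζ) * v) (ζ ^ 7 * v) .acute :=
    ⟨norm_zeta_pow_mul _ hv, rhomb_congr m8 (by grind) (by grind)⟩
  have f : Fan (inflate T') (silver * p + (1 + ζ) * v) v
      [.left, .obtuse, .right, .acute] :=
    ⟨c1, c2.cast rfl (by simp only [Corner.angle]),
      c3.cast rfl (by simp only [Corner.angle]; ring),
      c4.cast rfl (by simp only [Corner.angle]; ring), trivial⟩
  have hs : fanSides v [.left, .obtuse, .right, .acute] =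
      [v, ζ ^ 2 * v, ζ ^ 5 * v, ζ ^ 7 * v] := by
    simp only [fanSides_cons, fanSides_nil, Corner.angle, List.cons.injEq, and_true, true_and]
    grind
  have e1 := hw.eq_one_of_mem hT c1 o3 (by grind)
  have e2 := hw.eq_one_of_mem hT c2 (corner_mem_outline k2) (by grind)
  have e3 : w s(silver * p + (1 + ζ) * v,
      silver * p + (1 + ζ) * v + ζ ^ 5 * v) = 2 := by
    rw [show silver * p + (1 + ζ) * v + ζ ^ 5 * v =
      silver * p + v by grind, Sym2.eq_swap]
    exact w1
  have e4 : w s(silver * p + (1 + ζ) * v,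
      silver * p + (1 + ζ) * v + ζ ^ 7 * v) = 1 := by
    rw [show silver * p + (1 + ζ) * v + ζ ^ 7 * v =
      silver * p + (1 + ζ + ζ ^ 7) * v by grind, Sym2.eq_swap]
    exact w3
  rw [hT.weightedDegree_eq w hv f rfl, hs]
  simp only [List.map_cons, List.map_nil,
    List.sum_cons, List.sum_nil, Nat.reduceAdd, e1, e2, e3, e4]

/-- The weighted degree at the left corner of the inner square in the supertile of a square. -/
theorem weightedDegree_square_left (hT' : IsTiling T') (hT : IsTiling (inflate T'))
    (hw : IsWeighting (inflate T') T' w) {p v : ℂ} (hv : ‖v‖ = 1) (h : square p v ∈ T') :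
    weightedDegree (graph (inflate T')) w (silver * p + (1 + ζ ^ 7) * v) = 5 := by
  have h4 := zeta_pow_four
  have hl := silver_eq
  obtain ⟨m1, m2, m3, m4, m5, m6, m7, m8, m9⟩ := square_inflate hv h
  obtain ⟨o1, o2, o3, o4⟩ := square_outline hT' hT hv h
  obtain ⟨k1, k2, k3, k4⟩ := square_corners hv h
  obtain ⟨w1, w2, w3, w4⟩ := hw.internal p v hv h
  have c1 : HasCorner (inflate T') (silver * p + (1 + ζ ^ 7) * v) v .acute :=
    ⟨hv, rhomb_congr m9 (by grind) (by grind)⟩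
  have c2 : HasCorner (inflate T') (silver * p + (1 + ζ ^ 7) * v) (ζ * v) .left :=
    ⟨norm_zeta_mul hv, square_congr m1 (by grind) (by grind)⟩
  have c3 : HasCorner (inflate T') (silver * p + (1 + ζ ^ 7) * v) (ζ ^ 3 * v) .obtuse :=
    ⟨norm_zeta_pow_mul _ hv, rhomb_congr_rotate m7 (by grind) (by grind)⟩
  have c4 : HasCorner (inflate T') (silver * p + (1 + ζ ^ 7) * v) (ζ ^ 6 * v) .right :=
    ⟨norm_zeta_pow_mul _ hv, square_congr m5 (by grind) (by grind)⟩
  have f : Fan (inflate T') (silver * p + (1 + ζ ^ 7) * v) v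
      [.acute, .left, .obtuse, .right] :=
    ⟨c1, c2.cast rfl (by simp only [Corner.angle]; ring),
      c3.cast rfl (by simp only [Corner.angle]; ring),
      c4.cast rfl (by simp only [Corner.angle]; ring), trivial⟩
  have hs : fanSides v [.acute, .left, .obtuse, .right] =
      [v, ζ * v, ζ ^ 3 * v, ζ ^ 6 * v] := by
    simp only [fanSides_cons, fanSides_nil, Corner.angle, List.cons.injEq, and_true, true_and]
    grind
  have e1 := hw.eq_one_of_mem hT c1 o4 (by grind)
  have e2 : w s(silver * p + (1 + ζ ^ 7) * v,
      silver * p + (1 + ζ ^ 7) * v + ζ * v) = 1 := by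
    rw [show silver * p + (1 + ζ ^ 7) * v + ζ * v =
      silver * p + (1 + ζ + ζ ^ 7) * v by grind, Sym2.eq_swap]
    exact w4
  have e3 : w s(silver * p + (1 + ζ ^ 7) * v,
      silver * p + (1 + ζ ^ 7) * v + ζ ^ 3 * v) = 2 := by
    rw [show silver * p + (1 + ζ ^ 7) * v + ζ ^ 3 * v =
      silver * p + v by grind, Sym2.eq_swap]
    exact w2
  have e4 := hw.eq_one_of_mem hT c4 (corner_mem_outline k4) (by grind)
  rw [hT.weightedDegree_eq w hv f rfl, hs]
  simp only [List.map_cons, List.map_nil,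
    List.sum_cons, List.sum_nil, Nat.reduceAdd, e1, e2, e3, e4]

/-- The weighted degree at the tail of the inner square in the supertile of a square. -/
theorem weightedDegree_square_tail (hT' : IsTiling T') (hT : IsTiling (inflate T'))
    (hw : IsWeighting (inflate T') T' w) {p v : ℂ} (hv : ‖v‖ = 1) (h : square p v ∈ T') :
    weightedDegree (graph (inflate T')) w (silver * p + (1 + ζ + ζ ^ 7) * v) = 3 := by
  have h4 := zeta_pow_four
  have hl := silver_eq
  obtain ⟨m1, m2, m3, m4, m5, m6, m7, m8, m9⟩ := square_inflate hv h
  obtain ⟨o1, o2, o3, o4⟩ := square_outline hT' hT hv h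
  obtain ⟨k1, k2, k3, k4⟩ := square_corners hv h
  obtain ⟨w1, w2, w3, w4⟩ := hw.internal p v hv h
  have c1 : HasCorner (inflate T') (silver * p + (1 + ζ + ζ ^ 7) * v) v .obtuse :=
    ⟨hv, rhomb_congr m8 (by grind) (by grind)⟩
  have c2 : HasCorner (inflate T') (silver * p + (1 + ζ + ζ ^ 7) * v) (ζ ^ 3 * v) .tail :=
    ⟨norm_zeta_pow_mul _ hv, square_congr m1 (by grind) (by grind)⟩
  have c3 : HasCorner (inflate T') (silver * p + (1 + ζ + ζ ^ 7) * v) (ζ ^ 5 * v) .obtuse :=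
    ⟨norm_zeta_pow_mul _ hv, rhomb_congr_rotate m9 (by grind) (by grind)⟩
  have f : Fan (inflate T') (silver * p + (1 + ζ + ζ ^ 7) * v) v
      [.obtuse, .tail, .obtuse] :=
    ⟨c1, c2.cast rfl (by simp only [Corner.angle]),
      c3.cast rfl (by simp only [Corner.angle]; ring), trivial⟩
  have hs : fanSides v [.obtuse, .tail, .obtuse] =
      [v, ζ ^ 3 * v, ζ ^ 5 * v] := by
    simp only [fanSides_cons, fanSides_nil, Corner.angle, List.cons.injEq, and_true, true_and]
    grind
  have e1 := hw.eq_one_of_mem hT c1 (corner_mem_outline k3) (by grind)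
  have e2 : w s(silver * p + (1 + ζ + ζ ^ 7) * v,
      silver * p + (1 + ζ + ζ ^ 7) * v + ζ ^ 3 * v) = 1 := by
    rw [show silver * p + (1 + ζ + ζ ^ 7) * v + ζ ^ 3 * v =
      silver * p + (1 + ζ) * v by grind]
    exact w3
  have e3 : w s(silver * p + (1 + ζ + ζ ^ 7) * v,
      silver * p + (1 + ζ + ζ ^ 7) * v + ζ ^ 5 * v) = 1 := by
    rw [show silver * p + (1 + ζ + ζ ^ 7) * v + ζ ^ 5 * v =
      silver * p + (1 + ζ ^ 7) * v by grind]
    exact w4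
  rw [hT.weightedDegree_eq w hv f rfl, hs]
  simp only [List.map_cons, List.map_nil,
    List.sum_cons, List.sum_nil, Nat.reduceAdd, e1, e2, e3]

/-- The weighted degree at one of the two inner vertices of the supertile of a rhomb. -/
theorem weightedDegree_rhomb (hT' : IsTiling T') (hT : IsTiling (inflate T'))
    (hw : IsWeighting (inflate T') T' w) {p v : ℂ} (hv : ‖v‖ = 1) (h : rhomb p v ∈ T') :
    weightedDegree (graph (inflate T')) w (silver * p + (1 + ζ) * v) = 4 := by
  have h4 := zeta_pow_four
  have hl := silver_eq
  obtain ⟨m1, m2, m3, m4, m5, m6, m7⟩ := rhomb_inflate hv h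
  obtain ⟨o1, o2, o3, o4⟩ := rhomb_outline hT' hT hv h
  obtain ⟨k1, k2, k3, k4⟩ := rhomb_corners hv h
  have c1 : HasCorner (inflate T') (silver * p + (1 + ζ) * v) (ζ ^ 2 * v) .right :=
    ⟨norm_zeta_pow_mul _ hv, square_congr m5 (by grind) (by grind)⟩
  have c2 : HasCorner (inflate T') (silver * p + (1 + ζ) * v) (ζ ^ 4 * v) .acute :=
    ⟨norm_zeta_pow_mul _ hv, rhomb_congr_rotate m1 (by grind) (by grind)⟩
  have c3 : HasCorner (inflate T') (silver * p + (1 + ζ) * v) (ζ ^ 5 * v) .left :=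
    ⟨norm_zeta_pow_mul _ hv, square_congr m4 (by grind) (by grind)⟩
  have c4 : HasCorner (inflate T') (silver * p + (1 + ζ) * v) (ζ ^ 7 * v) .obtuse :=
    ⟨norm_zeta_pow_mul _ hv, rhomb_congr m2 (by grind) (by grind)⟩
  have f : Fan (inflate T') (silver * p + (1 + ζ) * v) (ζ ^ 2 * v)
      [.right, .acute, .left, .obtuse] :=
    ⟨c1, c2.cast rfl (by simp only [Corner.angle]; ring),
      c3.cast rfl (by simp only [Corner.angle]; ring),
      c4.cast rfl (by simp only [Corner.angle]; ring), trivial⟩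
  have hs : fanSides (ζ ^ 2 * v) [.right, .acute, .left, .obtuse] =
      [ζ ^ 2 * v, ζ ^ 4 * v, ζ ^ 5 * v, ζ ^ 7 * v] := by
    simp only [fanSides_cons, fanSides_nil, Corner.angle, List.cons.injEq, and_true, true_and]
    grind
  have e1 := hw.eq_one_of_mem hT c1 (corner_mem_outline k4) (by grind)
  have e2 := hw.eq_one_of_mem hT c2 o2 (by grind)
  have e3 := hw.eq_one_of_mem hT c3 o1 (by grind)
  have e4 := hw.eq_one_of_mem hT c4 (corner_mem_outline k2) (by grind)
  rw [hT.weightedDegree_eq w (norm_zeta_pow_mul _ hv) f rfl, hs]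
  simp only [List.map_cons, List.map_nil,
    List.sum_cons, List.sum_nil, Nat.reduceAdd, e1, e2, e3, e4]

end

theorem hasDisplayedSums {T' : Set Tile} {w : Sym2 ℂ → ℕ} (hT' : IsTiling T')
    (hT : IsTiling (inflate T')) (hw : IsWeighting (inflate T') T' w) :
    HasDisplayedSums (inflate T') T' w := by
  have h4 := zeta_pow_four
  have hl := silver_eq
  constructor
  · intro p v hv h
    obtain ⟨d1, d2, d3, d4⟩ := square_diagonalSides hT' hT hv h
    refine ⟨weightedDegree_square_head hT' hT hw hv h, weightedDegree_square_right hT' hT hw hv h,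
      weightedDegree_square_left hT' hT hw hv h, weightedDegree_square_tail hT' hT hw hv h,
      ?_, ?_, ?_, ?_⟩
    · rw [← d1.weightedDegree_eq hT hw]; congr 1; grind
    · rw [← d2.weightedDegree_eq hT hw]; congr 1; grind
    · rw [← d3.weightedDegree_eq hT hw]; congr 1; grind
    · rw [← d4.weightedDegree_eq hT hw]; congr 1; grind
  · intro p v hv h
    obtain ⟨d1, d2, d3, d4⟩ := rhomb_diagonalSides hT' hT hv h
    refine ⟨weightedDegree_rhomb hT' hT hw hv h, ?_, ?_, ?_, ?_, ?_⟩
    · -- the half-turn of the rhomb exchanges the two inner vertices of its supertile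
      rw [← weightedDegree_rhomb hT' hT hw (p := p + (1 + ζ) * v) (v := -v) (by simpa using hv)
        (by rwa [rhomb_rotate])]
      congr 1; grind
    · rw [← d1.weightedDegree_eq hT hw]; congr 1; grind
    · rw [← d2.weightedDegree_eq hT hw]; congr 1; grind
    · rw [← d3.weightedDegree_eq hT hw]; congr 1; grind
    · rw [← d4.weightedDegree_eq hT hw]; congr 1; grind

/-! ### The colouring -/

/-- The pair `a`, `b` has an admissible weight, or meets an outline, and its ends have different
weighted degrees. -/
def IsGoodPair (T' : Set Tile) (w : Sym2 ℂ → ℕ) (a b : ℂ) : Prop :=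
  (a ∈ outline T' ∨ b ∈ outline T' ∨ w s(a, b) = 1 ∨ w s(a, b) = 2) ∧
    weightedDegree (graph (inflate T')) w a ≠ weightedDegree (graph (inflate T')) w b

theorem IsGoodPair.symm {T' : Set Tile} {w : Sym2 ℂ → ℕ} {a b : ℂ} (h : IsGoodPair T' w a b) :
    IsGoodPair T' w b a := by
  obtain ⟨h1, h2⟩ := h
  rw [Sym2.eq_swap] at h1
  exact ⟨by tauto, h2.symm⟩

/-- The four sides of a square, with its corners given in any form. -/
theorem isGoodPair_of_square {T' : Set Tile} {w : Sym2 ℂ → ℕ} {q r a b c d x y : ℂ}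
    (ha : q = a) (hb : q + ζ * r = b) (hc : q + (ζ + ζ ^ 7) * r = c) (hd : q + ζ ^ 7 * r = d)
    (h1 : IsGoodPair T' w a b) (h2 : IsGoodPair T' w b c) (h3 : IsGoodPair T' w c d)
    (h4 : IsGoodPair T' w d a) (h : s(x, y) ∈ (square q r).sides) : IsGoodPair T' w x y := by
  subst ha hb hc hd
  simp only [square, Set.mem_insert_iff, Set.mem_singleton_iff, Sym2.eq_iff] at h
  rcases h with (⟨rfl, rfl⟩ | ⟨rfl, rfl⟩) | (⟨rfl, rfl⟩ | ⟨rfl, rfl⟩) |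
    (⟨rfl, rfl⟩ | ⟨rfl, rfl⟩) | (⟨rfl, rfl⟩ | ⟨rfl, rfl⟩)
  exacts [h1, h1.symm, h2, h2.symm, h3, h3.symm, h4, h4.symm]

/-- The four sides of a rhomb, with its corners given in any form. -/
theorem isGoodPair_of_rhomb {T' : Set Tile} {w : Sym2 ℂ → ℕ} {q r a b c d x y : ℂ}
    (ha : q = a) (hb : q + r = b) (hc : q + (1 + ζ) * r = c) (hd : q + ζ * r = d)
    (h1 : IsGoodPair T' w a b) (h2 : IsGoodPair T' w b c) (h3 : IsGoodPair T' w c d)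
    (h4 : IsGoodPair T' w d a) (h : s(x, y) ∈ (rhomb q r).sides) : IsGoodPair T' w x y := by
  subst ha hb hc hd
  simp only [rhomb, Set.mem_insert_iff, Set.mem_singleton_iff, Sym2.eq_iff] at h
  rcases h with (⟨rfl, rfl⟩ | ⟨rfl, rfl⟩) | (⟨rfl, rfl⟩ | ⟨rfl, rfl⟩) |
    (⟨rfl, rfl⟩ | ⟨rfl, rfl⟩) | (⟨rfl, rfl⟩ | ⟨rfl, rfl⟩)
  exacts [h1, h1.symm, h2, h2.symm, h3, h3.symm, h4, h4.symm]

section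

variable {T' : Set Tile} {w : Sym2 ℂ → ℕ}

/-- The two corners of a halved square beside its diagonal are inner vertices of the supertiles on
either side. -/
theorem isGoodPair_of_halfSquare (hT' : IsTiling T') (hT : IsTiling (inflate T'))
    (hr : SideCornersMeetRhombs T') (hw : IsWeighting (inflate T') T' w) {x d a b : ℂ}
    (h : IsDiagonalSide T' x d)
    (hab : s(a, b) ∈ (square (silver * x + (ζ + ζ ^ 7) * d) (-d)).sides) :
    IsGoodPair T' w a b := by
  have h4 := zeta_pow_four
  have hl := silver_eq
  have hs := hasDisplayedSums hT' hT hw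
  have ho := h.mem_outline
  have h3 := h.weightedDegree_eq hT hw
  obtain ⟨c, hc, hc'⟩ := h.left
  have hox := corner_mem_outline hc
  have hleft : weightedDegree (graph (inflate T')) w (silver * x + ζ * d) ≠ 3 ∧
      weightedDegree (graph (inflate T')) w (silver * x) ≠
        weightedDegree (graph (inflate T')) w (silver * x + ζ * d) := by
    obtain ⟨-, n4, n7, n5⟩ := weightedDegree_corner hT' hT hr hw hc
    have hd := hc.norm_eq
    have hm := hc.mem
    cases c <;> simp only [Corner.StartsDiagonal] at hc' <;> simp only [Corner.tile] at hm
    · have e := (hs.rhomb_sums _ _ (norm_zeta_pow_mul _ hd) hm).2.1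
      rw [show silver * x + ζ * d = silver * (x + ζ ^ 3 * d) +
        (1 + ζ + ζ ^ 2 + ζ ^ 7) * (ζ ^ 7 * d) by grind, e]
      exact ⟨by norm_num, n4 rfl⟩
    · have e := (hs.square_sums _ _ (norm_zeta_mul hd) hm).1
      rw [e]
      exact ⟨by norm_num, n7 rfl⟩
    · have e := (hs.square_sums _ _ (norm_zeta_pow_mul _ hd) hm).2.2.1
      rw [show silver * x + ζ * d = silver * (x + ζ ^ 2 * d) +
        (1 + ζ ^ 7) * (ζ ^ 7 * d) by grind, e]
      exact ⟨by norm_num, n5 (Or.inr rfl)⟩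
  have hright : weightedDegree (graph (inflate T')) w (silver * x + ζ ^ 7 * d) ≠ 3 ∧
      weightedDegree (graph (inflate T')) w (silver * x) ≠
        weightedDegree (graph (inflate T')) w (silver * x + ζ ^ 7 * d) := by
    clear hc hc' hox
    obtain ⟨u, c, hc, hc', rfl⟩ := h.right
    obtain ⟨-, n4, n7, n5⟩ := weightedDegree_corner hT' hT hr hw hc
    have hd := hc.norm_eq
    have hm := hc.mem
    cases c <;> simp only [Corner.EndsDiagonal] at hc' <;> simp only [Corner.tile] at hm <;>
      simp only [Corner.angle]
    · have e := (hs.rhomb_sums _ _ (norm_zeta_pow_mul _ hd) hm).1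
      rw [show silver * x + ζ ^ 7 * (ζ ^ 3 * u) = silver * (x + ζ ^ 3 * u) +
        (1 + ζ) * (ζ ^ 7 * u) by grind, e]
      exact ⟨by norm_num, n4 rfl⟩
    · have e := (hs.square_sums _ _ (norm_zeta_mul hd) hm).1
      rw [show silver * x + ζ ^ 7 * (ζ ^ 2 * u) = silver * x + ζ * u by grind, e]
      exact ⟨by norm_num, n7 rfl⟩
    · have e := (hs.square_sums _ _ (norm_zeta_pow_mul _ hd) hm).2.1
      rw [show silver * x + ζ ^ 7 * (ζ ^ 2 * u) = silver * (x + u) +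
        (1 + ζ) * (ζ ^ 3 * u) by grind, e]
      exact ⟨by norm_num, n5 (Or.inl rfl)⟩
  refine isGoodPair_of_square (a := silver * x + (ζ + ζ ^ 7) * d) (b := silver * x + ζ ^ 7 * d)
    (c := silver * x) (d := silver * x + ζ * d) (by grind) (by grind) (by grind) (by grind)
    ⟨Or.inl ho, ?_⟩ ⟨Or.inr (Or.inl hox), hright.2.symm⟩ ⟨Or.inl hox, hleft.2⟩
    ⟨Or.inr (Or.inl ho), ?_⟩ hab
  · rw [h3]; exact hright.1.symm
  · rw [h3]; exact hleft.1

/-- The sides of the inner square and of the rhombs in the supertile of a square. -/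
theorem isGoodPair_of_squareSupertile (hT' : IsTiling T') (hT : IsTiling (inflate T'))
    (hr : SideCornersMeetRhombs T') (hw : IsWeighting (inflate T') T' w) {p v : ℂ} (hv : ‖v‖ = 1)
    (hp : square p v ∈ T') {t : Tile}
    (ht : t = square (silver * p + (1 + ζ + ζ ^ 7) * v) (ζ ^ 4 * v) ∨
      t = rhomb (silver * p + v) (ζ * v) ∨ t = rhomb (silver * p + v) (ζ ^ 6 * v) ∨
      t = rhomb (silver * p + (1 + ζ) * v) (ζ ^ 7 * v) ∨
      t = rhomb (silver * p + (1 + ζ ^ 7) * v) v)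
    {x y : ℂ} (hxy : s(x, y) ∈ t.sides) : IsGoodPair T' w x y := by
  have h4 := zeta_pow_four
  have hl := silver_eq
  obtain ⟨s1, s2, s3, s4, t1, t2, t3, t4⟩ := (hasDisplayedSums hT' hT hw).square_sums p v hv hp
  obtain ⟨o1, o2, o3, o4⟩ := square_outline hT' hT hv hp
  obtain ⟨w1, w2, w3, w4⟩ := hw.internal p v hv hp
  obtain ⟨-, c2, c3, c4⟩ := square_corners hv hp
  have k2 := corner_mem_outline c2
  have k3 := corner_mem_outline c3
  have k4 := corner_mem_outline c4
  obtain ⟨n2, -, -, m2⟩ := weightedDegree_corner hT' hT hr hw c2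
  obtain ⟨n3, -⟩ := weightedDegree_corner hT' hT hr hw c3
  obtain ⟨n4, -, -, m4⟩ := weightedDegree_corner hT' hT hr hw c4
  have g12 : IsGoodPair T' w (silver * p + v) (silver * p + (1 + ζ) * v) :=
    ⟨Or.inr (Or.inr (Or.inr w1)), by rw [s1, s2]; norm_num⟩
  have g13 : IsGoodPair T' w (silver * p + v) (silver * p + (1 + ζ ^ 7) * v) :=
    ⟨Or.inr (Or.inr (Or.inr w2)), by rw [s1, s3]; norm_num⟩
  have g42 : IsGoodPair T' w (silver * p + (1 + ζ + ζ ^ 7) * v) (silver * p + (1 + ζ) * v) :=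
    ⟨Or.inr (Or.inr (Or.inl w3)), by rw [s4, s2]; norm_num⟩
  have g43 : IsGoodPair T' w (silver * p + (1 + ζ + ζ ^ 7) * v)
      (silver * p + (1 + ζ ^ 7) * v) :=
    ⟨Or.inr (Or.inr (Or.inl w4)), by rw [s4, s3]; norm_num⟩
  rcases ht with rfl | rfl | rfl | rfl | rfl
  · exact isGoodPair_of_square rfl (b := silver * p + (1 + ζ ^ 7) * v) (c := silver * p + v)
      (d := silver * p + (1 + ζ) * v) (by clear * - h4 hl; grind) (by clear * - h4 hl; grind)
      (by clear * - h4 hl; grind) g43 g13.symm g12 g42.symm hxy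
  · exact isGoodPair_of_rhomb rfl (b := silver * p + (1 + ζ) * v) (c := silver * (p + ζ * v))
      (d := silver * p + (1 + ζ ^ 2) * v) (by clear * - h4 hl; grind) (by clear * - h4 hl; grind)
      (by clear * - h4 hl; grind) g12
      ⟨Or.inr (Or.inl k2), by rw [s2]; exact (m2 (Or.inl rfl)).symm⟩
      ⟨Or.inl k2, by rw [t1]; exact n2⟩ ⟨Or.inl o1, by rw [t1, s1]; norm_num⟩ hxy
  · exact isGoodPair_of_rhomb rfl (b := silver * p + (1 + ζ ^ 6) * v)
      (c := silver * (p + ζ ^ 7 * v)) (d := silver * p + (1 + ζ ^ 7) * v)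
      (by clear * - h4 hl; grind) (by clear * - h4 hl; grind) (by clear * - h4 hl; grind)
      ⟨Or.inr (Or.inl o2), by rw [t2, s1]; norm_num⟩ ⟨Or.inl o2, by rw [t2]; exact n4.symm⟩
      ⟨Or.inl k4, by rw [s3]; exact m4 (Or.inr rfl)⟩ g13.symm hxy
  · exact isGoodPair_of_rhomb rfl (b := silver * p + (1 + ζ + ζ ^ 7) * v)
      (c := silver * (p + (ζ + ζ ^ 7) * v)) (d := silver * p + (2 + ζ) * v)
      (by clear * - h4 hl; grind) (by clear * - h4 hl; grind) (by clear * - h4 hl; grind) g42.symm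
      ⟨Or.inr (Or.inl k3), by rw [s4]; exact n3.symm⟩ ⟨Or.inl k3, by rw [t3]; exact n3⟩
      ⟨Or.inl o3, by rw [t3, s2]; norm_num⟩ hxy
  · exact isGoodPair_of_rhomb rfl (b := silver * p + (2 + ζ ^ 7) * v)
      (c := silver * (p + (ζ + ζ ^ 7) * v)) (d := silver * p + (1 + ζ + ζ ^ 7) * v)
      (by clear * - h4 hl; grind) (by clear * - h4 hl; grind) (by clear * - h4 hl; grind)
      ⟨Or.inr (Or.inl o4), by rw [s3, t4]; norm_num⟩
      ⟨Or.inl o4, by rw [t4]; exact n3.symm⟩ ⟨Or.inl k3, by rw [s4]; exact n3⟩ g43 hxy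

/-- The sides of the rhombs in the supertile of a rhomb. -/
theorem isGoodPair_of_rhombSupertile (hT' : IsTiling T') (hT : IsTiling (inflate T'))
    (hr : SideCornersMeetRhombs T') (hw : IsWeighting (inflate T') T' w) {p v : ℂ} (hv : ‖v‖ = 1)
    (hp : rhomb p v ∈ T') {t : Tile}
    (ht : t = rhomb (silver * p) v ∨
      t = rhomb (silver * p + (1 + ζ + ζ ^ 2) * v) (ζ ^ 6 * v) ∨
      t = rhomb (silver * p + (1 + ζ + ζ ^ 2 + ζ ^ 7) * v) v)
    {x y : ℂ} (hxy : s(x, y) ∈ t.sides) : IsGoodPair T' w x y := by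
  have h4 := zeta_pow_four
  have hl := silver_eq
  obtain ⟨s1, s2, t1, t2, t3, t4⟩ := (hasDisplayedSums hT' hT hw).rhomb_sums p v hv hp
  obtain ⟨o1, o2, o3, o4⟩ := rhomb_outline hT' hT hv hp
  obtain ⟨c1, c2, c3, c4⟩ := rhomb_corners hv hp
  have k1 := corner_mem_outline c1
  have k2 := corner_mem_outline c2
  have k3 := corner_mem_outline c3
  have k4 := corner_mem_outline c4
  obtain ⟨n1, -⟩ := weightedDegree_corner hT' hT hr hw c1
  obtain ⟨n2, m2, -⟩ := weightedDegree_corner hT' hT hr hw c2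
  obtain ⟨n3, -⟩ := weightedDegree_corner hT' hT hr hw c3
  obtain ⟨n4, m4, -⟩ := weightedDegree_corner hT' hT hr hw c4
  have m2 := m2 rfl
  have m4 := m4 rfl
  rcases ht with rfl | rfl | rfl
  · exact isGoodPair_of_rhomb rfl rfl rfl rfl ⟨Or.inl k1, by rw [t1]; exact n1⟩
      ⟨Or.inl o1, by rw [t1, s1]; norm_num⟩ ⟨Or.inr (Or.inl o2), by rw [t2, s1]; norm_num⟩
      ⟨Or.inl o2, by rw [t2]; exact n1.symm⟩ hxy
  · exact isGoodPair_of_rhomb (a := silver * (p + ζ * v)) (b := silver * p + (1 + ζ) * v)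
      (c := silver * (p + v)) (d := silver * p + (1 + ζ + ζ ^ 2 + ζ ^ 7) * v)
      (by clear * - h4 hl; grind) (by clear * - h4 hl; grind) (by clear * - h4 hl; grind)
      (by clear * - h4 hl; grind)
      ⟨Or.inl k4, by rw [s1]; exact m4⟩ ⟨Or.inr (Or.inl k2), by rw [s1]; exact m2.symm⟩
      ⟨Or.inl k2, by rw [s2]; exact m2⟩ ⟨Or.inr (Or.inl k4), by rw [s2]; exact m4.symm⟩ hxy
  · exact isGoodPair_of_rhomb rfl (b := silver * p + (2 + ζ + ζ ^ 2 + ζ ^ 7) * v)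
      (c := silver * (p + (1 + ζ) * v)) (d := silver * p + (1 + 2 * ζ + ζ ^ 2 + ζ ^ 7) * v)
      (by clear * - h4 hl; grind) (by clear * - h4 hl; grind) (by clear * - h4 hl; grind)
      ⟨Or.inr (Or.inl o4), by rw [s2, t4]; norm_num⟩ ⟨Or.inl o4, by rw [t4]; exact n3.symm⟩
      ⟨Or.inl k3, by rw [t3]; exact n3⟩ ⟨Or.inl o3, by rw [s2, t3]; norm_num⟩ hxy

theorem isGoodPair_of_mem_sides (hT' : IsTiling T') (hT : IsTiling (inflate T'))
    (hr : SideCornersMeetRhombs T') (hw : IsWeighting (inflate T') T' w) {t : Tile}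
    (ht : t ∈ inflate T') {x y : ℂ} (hxy : s(x, y) ∈ t.sides) : IsGoodPair T' w x y := by
  rcases mem_inflate_cases hT' hT ht with ⟨p, v, hv, hp, ht⟩ | ⟨p, v, hv, hp, ht⟩ | ⟨x, d, hd, rfl⟩
  · exact isGoodPair_of_squareSupertile hT' hT hr hw hv hp ht hxy
  · exact isGoodPair_of_rhombSupertile hT' hT hr hw hv hp ht hxy
  · exact isGoodPair_of_halfSquare hT' hT hr hw hd hxy

theorem isSolution123 (hT' : IsTiling T') (hT : IsTiling (inflate T'))
    (hr : SideCornersMeetRhombs T') (hw : IsWeighting (inflate T') T' w) :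
    IsSolution123 (graph (inflate T')) w := by
  refine ⟨hT.finite_neighborSet, ?_, ?_⟩
  · intro e he
    induction e with
    | _ x y =>
      obtain ⟨-, t, ht, hxy⟩ := id he
      rcases (isGoodPair_of_mem_sides hT' hT hr hw ht hxy).1 with h | h | h | h
      · simp [hw.external _ he ⟨x, Sym2.mem_mk_left _ _, h⟩]
      · simp [hw.external _ he ⟨y, Sym2.mem_mk_right _ _, h⟩]
      · simp [h]
      · simp [h]
  · rintro x y ⟨-, t, ht, hxy⟩
    exact (isGoodPair_of_mem_sides hT' hT hr hw ht hxy).2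

end

theorem IsAmmannBeenker.exists_decomposition {T : Set Tile} (h : IsAmmannBeenker T) :
    ∃ T', IsDecomposition T T' := by
  obtain ⟨S, rfl, hS⟩ := h
  exact ⟨S 1, ⟨fun n => S (n + 1), rfl, fun n => hS (n + 1)⟩, (hS 0).2.symm⟩

end AmmannBeenker

end

theorem mainTheorem3 (T : Set AmmannBeenker.Tile) (hT : AmmannBeenker.IsAmmannBeenker T) :
    (∃ T', AmmannBeenker.IsDecomposition T T') ∧
    ∀ T', AmmannBeenker.IsDecomposition T T' →
      (∃ w, AmmannBeenker.IsWeighting T T' w) ∧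
      ∀ w, AmmannBeenker.IsWeighting T T' w →
        AmmannBeenker.IsSolution123 (AmmannBeenker.graph T) w ∧
        AmmannBeenker.HasDisplayedSums T T' w := by
  refine ⟨hT.exists_decomposition, ?_⟩
  rintro T' ⟨⟨S', hS'0, hS'⟩, rfl⟩
  obtain ⟨S, hS0, hS⟩ := hT
  have h1 : AmmannBeenker.IsTiling (AmmannBeenker.inflate T') := hS0 ▸ (hS 0).1
  have h2 : AmmannBeenker.IsTiling T' := hS'0 ▸ (hS' 0).1
  -- the side corners of squares meet rhombs in `T'` because `T'` is itself an inflated tiling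
  have h3 : AmmannBeenker.SideCornersMeetRhombs T' := by
    have e : T' = AmmannBeenker.inflate (S' 1) := hS'0 ▸ (hS' 0).2
    have h4 : AmmannBeenker.IsTiling (S' 1) := (hS' 1).1
    rw [e] at h2 ⊢
    exact AmmannBeenker.sideCornersMeetRhombs_inflate h4 h2
  exact ⟨AmmannBeenker.exists_isWeighting h2 _, fun w hw =>
    ⟨AmmannBeenker.isSolution123 h2 h1 h3 hw, AmmannBeenker.hasDisplayedSums h2 h1 hw⟩⟩
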